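/- **Setting.** A second order non-commutative $*$-probability space $(\mathcal A,\varphi,\varphi_2)$ is a unital complex $*$-algebra $\mathcal A$ with a linear functional $\varphi:\mathcal A\to\mathbb C$ such that $\varphi(1)=1$ and $\varphi(xy)=\varphi(yx)$, and a bilinear functional $\varphi_2:\mathcal A\times\mathcal A\to\mathbb C$ that is symmetric, tracial in each variable, and satisfies $\varphi_2(1,x)=\varphi_2(x,1)=0$ for all $x$. For a permutation $\pi$ of $[n]=\{1,\dots,n\}$ let $|\pi|=n-\#(\pi)$, where $\#(\pi)$ is the number of cycles (fixed points included). Let $\gamma_n=(1,2,\dots,n)$ and $\gamma_{m,n}=(1,\dots,m)(m+1,\dots,m+n)$. Let $NC(n)$ be the set of permutations $\pi$ of $[n]$ with $|\gamma_n|=|\pi|+|\pi^{-1}\gamma_n|$ (these are the non-crossing partitions of $[n]$, each block being read as a cycle in increasing order), and let $S_{NC}(m,n)$ be the set of permutations $\pi$ of $[m+n]$ that have a cycle meeting both $\{1,\dots,m\}$ and $\{m+1,\dots,m+n\}$ and satisfy $|\gamma_{m,n}|+2=|\pi|+|\pi^{-1}\gamma_{m,n}|$. For a permutation $\pi$ put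 $\kappa_\pi(x_1,\dots,x_n)=\prod_{c}\kappa_l(x_{i_1},\dots,x_{i_l})$, the product being over the cycles $c=(i_1,\dots,i_l)$ of $\pi$, each written starting with its least element. The first order cumulants $\kappa_n$ ($n\ge1$) and the second order cumulants $\kappa_{m,n}$ ($m,n\ge 1$) are defined recursively by the moment-cumulant formulas $$\varphi(x_1\cdots x_n)=\sum_{\pi\in NC(n)}\kappa_\pi(x_1,\dots,x_n),$$ $$\varphi_2(x_1\cdots x_m,\,x_{m+1}\cdots x_{m+n})=\sum_{\pi\in S_{NC}(m,n)}\kappa_\pi(x_1,\dots,x_{m+n})+\sum_{(\mathcal U,\pi)}\kappa_{(\mathcal U,\pi)}(x_1,\dots,x_{m+n}).$$ Here the last sum is over all $\pi=\pi_1\times\pi_2$ with $\pi_1\in NC(m)$ and $\pi_2\in NC(n)$ (acting on $\{m+1,\dots,m+n\}$), and over all partitions $\mathcal U$ obtained from the cycles of $\pi$ by joining one cycle $(i_1,\dots,i_k)$ of $\pi_1$ with one cycle $(j_1,\dots,j_l)$ of $\pi_2$; $\kappa_{(\mathcal U,\pi)}$ is $\kappa_{k,l}(x_{i_1},\dots,x_{i_k};x_{j_1},\dots,x_{j_l})$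 times the product of the first order cumulants of $x_1,\dots,x_{m+n}$ along all the other cycles of $\pi$, cycles again being written starting with their least element. Two sets $S_1,S_2\subseteq\mathcal A$ are *second order free* if all mixed cumulants vanish: $\kappa_n(x_1,\dots,x_n)=0$ and $\kappa_{m,n}(x_1,\dots,x_{m+n})=0$ whenever each $x_i\in S_{j_i}$ with $j_i\in\{1,2\}$ and the $j_i$ are not all equal. Write $a^{(1)}=a$ and $a^{(-1)}=a^*$, and call $(\epsilon_1,\dots,\epsilon_n)\in\{-1,1\}^n$ *alternating* if $n$ is even and $\epsilon_{i+1}=-\epsilon_i$ for $1\le i<n$. An element $a\in\mathcal A$ is *second order $R$-diagonal* if 1. $\kappa_n(a^{(\epsilon_1)},\dots,a^{(\epsilon_n)})=0$ for every $n\ge1$ and every $\epsilon$ that is not alternating; 2. $\kappa_{m,n}(a^{(\epsilon_1)},\dots,a^{(\epsilon_{m+n})})=0$ for all $m,n\ge1$ and all $\epsilon$, unless both $(\epsilon_1,\dots,\epsilon_m)$ and $(\epsilon_{m+1},\dots,\epsilon_{m+n})$ are alternating; 3. $\kappa_{2p,2q}(a,a^*,\dots,a,a^*)=\kappa_{2p,2q}(a^*,a,\dots,a^*,a)$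 for all $p,q\ge1$. **Theorem.** Let $(\mathcal A,\varphi,\varphi_2)$ be a second order non-commutative $*$-probability space and $a,b\in\mathcal A$. If $\{a,a^*\}$ and $\{b,b^*\}$ are second order free and $a$ is second order $R$-diagonal, then $ab$ is second order $R$-diagonal. -/

import Mathlib

open Equiv Finset

/-- A second order non-commutative probability space structure on a unital complex algebra `A`. -/
structure SecondOrderProbabilitySpace (A : Type*) [Ring A] [Algebra ℂ A] where
  /-- the expectation -/
  φ : A →ₗ[ℂ] ℂ
  /-- the fluctuation functional -/
  φ₂ : A →ₗ[ℂ] A →ₗ[ℂ] ℂ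
  φ_one : φ 1 = 1
  φ_trace : ∀ a b, φ (a * b) = φ (b * a)
  φ₂_symm : ∀ a b, φ₂ a b = φ₂ b a
  φ₂_trace_left : ∀ a b c, φ₂ (a * b) c = φ₂ (b * a) c
  φ₂_trace_right : ∀ a b c, φ₂ c (a * b) = φ₂ c (b * a)
  φ₂_one_left : ∀ a, φ₂ 1 a = 0
  φ₂_one_right : ∀ a, φ₂ a 1 = 0

noncomputable section

/-! ### Permutations: cycles, length, planar and annular non-crossing permutations -/

open scoped Classical in
/-- The least elements of the cycles of `π`; they index the cycles of `π`, fixed points being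
cycles of length one. -/
def cycleMinima {n : ℕ} (π : Perm (Fin n)) : Finset (Fin n) :=
  univ.filter fun i => ∀ j, π.SameCycle i j → i ≤ j

/-- `|π| = n - #(π)`, where `#(π)` is the number of cycles. -/
def permLength {n : ℕ} (π : Perm (Fin n)) : ℕ := n - (cycleMinima π).card

/-- The number of elements of the cycle of `π` through `i`. -/
def cycleLength {n : ℕ} (π : Perm (Fin n)) (i : Fin n) : ℕ := Function.minimalPeriod π i

/-- The entries `x i, x (π i), x (π² i), …` of `x` along the cycle of `π` through `i`. -/
def cycleWord {A : Type*} {n : ℕ} (π : Perm (Fin n)) (x : Fin n → A) (i : Fin n) :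
    Fin (cycleLength π i) → A :=
  fun k => x ((π ^ (k : ℕ)) i)

open scoped Classical in
/-- The non-crossing partitions of `n` points, as permutations whose cycles are the blocks in
increasing order: these are exactly the `π` with `|γ_n| = |π| + |π⁻¹ γ_n|`, where
`γ_n = (1, 2, …, n)`. -/
def NC (n : ℕ) : Finset (Perm (Fin n)) :=
  univ.filter fun π =>
    permLength (finRotate n) = permLength π + permLength (π⁻¹ * finRotate n)

/-- The permutation `γ_{m,n}` with the two cycles `(1, …, m)` and `(m+1, …, m+n)`. -/
def annularRotate (m n : ℕ) : Perm (Fin (m + n)) :=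
  finSumFinEquiv.permCongr (Perm.sumCongr (finRotate m) (finRotate n))

open scoped Classical in
/-- The non-crossing annular permutations `S_NC(m,n)`: some cycle of `π` meets both circles, and
`|γ_{m,n}| + 2 = |π| + |π⁻¹ γ_{m,n}|`. -/
def annularNC (m n : ℕ) : Finset (Perm (Fin (m + n))) :=
  univ.filter fun π =>
    (∃ (i : Fin m) (j : Fin n), π.SameCycle (Fin.castAdd n i) (Fin.natAdd m j)) ∧
      permLength (annularRotate m n) + 2 =
        permLength π + permLength (π⁻¹ * annularRotate m n)

/-! ### Facts which make the recursive definition of the cumulants well founded -/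

theorem cycleLength_le {n : ℕ} (π : Perm (Fin n)) (i : Fin n) : cycleLength π i ≤ n := by
  have h := Function.minimalPeriod_le_card (f := π) (x := i)
  simpa [cycleLength] using h

theorem eq_one_of_permLength_eq_zero {n : ℕ} {σ : Perm (Fin n)} (h : permLength σ = 0) :
    σ = 1 := by
  have hc : (cycleMinima σ).card = Fintype.card (Fin n) := by
    have h1 := Finset.card_le_univ (cycleMinima σ)
    simp only [Fintype.card_fin] at h1 ⊢
    unfold permLength at h
    omega
  have hu : cycleMinima σ = univ := (Finset.card_eq_iff_eq_univ _).mp hc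
  have hmem : ∀ i j, σ.SameCycle i j → i ≤ j := by
    intro i
    have hi : i ∈ cycleMinima σ := hu ▸ Finset.mem_univ i
    exact (Finset.mem_filter.mp hi).2
  ext i
  have hs : σ.SameCycle i (σ i) := ⟨1, by simp⟩
  exact congrArg Fin.val (le_antisymm (hmem _ _ hs.symm) (hmem _ _ hs))

theorem permLength_of_sameCycle {n : ℕ} {σ : Perm (Fin n)} (h : ∀ i j, σ.SameCycle i j) :
    permLength σ = n - 1 := by
  cases n with
  | zero => simp [permLength]
  | succ k =>
    have : cycleMinima σ = {0} := by
      ext i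
      simp only [cycleMinima, Finset.mem_filter, Finset.mem_univ, true_and,
        Finset.mem_singleton]
      refine ⟨fun hi => le_antisymm (hi 0 (h _ _)) (Fin.zero_le i), fun hi j _ => ?_⟩
      rw [hi]
      exact Fin.zero_le j
    simp [permLength, this]

theorem permLength_finRotate (n : ℕ) : permLength (finRotate n) = n - 1 := by
  apply permLength_of_sameCycle
  rcases Nat.lt_or_ge n 2 with h | h
  · have : Subsingleton (Fin n) := Fin.subsingleton_iff_le_one.mpr (by omega)
    intro i j
    rw [Subsingleton.elim i j]
  · have hc := isCycle_finRotate_of_le h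
    have hs : ∀ i, finRotate n i ≠ i := fun i => by
      rw [← Perm.mem_support, support_finRotate_of_le h]
      exact Finset.mem_univ i
    exact fun i j => hc.sameCycle (hs i) (hs j)

theorem cycleLength_lt {n : ℕ} {π : Perm (Fin n)} (hπ : π ∈ NC n) (hne : π ≠ finRotate n)
    (i : Fin n) : cycleLength π i < n := by
  refine lt_of_le_of_ne (cycleLength_le π i) fun hn => hne ?_
  have hinj : Function.Injective fun k : Fin n => (π ^ (k : ℕ)) i := by
    intro k l hkl
    simp only [Perm.coe_pow] at hkl
    have hk : (k : ℕ) < Function.minimalPeriod π i := k.2.trans_eq hn.symm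
    have hl : (l : ℕ) < Function.minimalPeriod π i := l.2.trans_eq hn.symm
    exact Fin.ext ((Function.iterate_eq_iterate_iff_of_lt_minimalPeriod hk hl).mp hkl)
  have hsame : ∀ j, π.SameCycle i j := fun j => by
    obtain ⟨k, hk⟩ := (Finite.injective_iff_surjective.mp hinj) j
    exact ⟨(k : ℕ), by simpa using hk⟩
  have hl := permLength_of_sameCycle fun j k => (hsame j).symm.trans (hsame k)
  have hnc := (Finset.mem_filter.mp hπ).2
  rw [permLength_finRotate, hl] at hnc
  exact (inv_mul_eq_one.mp (eq_one_of_permLength_eq_zero (by omega)))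

namespace SecondOrderProbabilitySpace

variable {A : Type*} [Ring A] [Algebra ℂ A] (P : SecondOrderProbabilitySpace A)

open scoped Classical in
/-- The first order free cumulant `κ_n(x_1, …, x_n)`, obtained by solving recursively the
moment-cumulant formula `φ(x_1 ⋯ x_n) = ∑_{π ∈ NC(n)} κ_π(x_1, …, x_n)`. In this formula the
term of `π = γ_n` is `κ_n(x_1, …, x_n)`, and all other terms involve shorter cumulants only. -/
def cumulant (n : ℕ) (x : Fin n → A) : ℂ :=
  P.φ (List.ofFn x).prod -
    ∑ π : {π : Perm (Fin n) // π ∈ NC n ∧ π ≠ finRotate n},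
      ∏ i ∈ cycleMinima π.1, cumulant (cycleLength π.1 i) (cycleWord π.1 x i)
termination_by n
decreasing_by exact cycleLength_lt π.2.1 π.2.2 i

/-- `κ_π(x_1, …, x_n)`, the product of the first order cumulants along the cycles of `π`. -/
def permCumulant {n : ℕ} (π : Perm (Fin n)) (x : Fin n → A) : ℂ :=
  ∏ i ∈ cycleMinima π, P.cumulant (cycleLength π i) (cycleWord π x i)

/-- The product of the first order cumulants along all cycles of `π` but the one with least
element `i`. -/
def unmarkedCumulant {n : ℕ} (π : Perm (Fin n)) (i : Fin n) (x : Fin n → A) : ℂ :=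
  ∏ k ∈ (cycleMinima π).erase i, P.cumulant (cycleLength π k) (cycleWord π x k)

open scoped Classical in
/-- The second order free cumulant `κ_{m,n}(x_1, …, x_m; y_1, …, y_n)`, obtained by solving
recursively the moment-cumulant formula
`φ₂(x_1 ⋯ x_m, y_1 ⋯ y_n) = ∑_{π ∈ S_NC(m,n)} κ_π(x, y) + ∑_{(U,π) ∈ PS_NC(m,n)'} κ_{(U,π)}(x, y)`.
An element `(U, π)` of `PS_NC(m,n)'` consists of `π = π₁ × π₂` with `π₁ ∈ NC(m)`, `π₂ ∈ NC(n)`,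
and of a cycle `i` of `π₁` and a cycle `j` of `π₂` which `U` joins; `κ_{(U,π)}` is the second
order cumulant along the two joined cycles, times the first order cumulants along all other cycles.
The term of `π = γ_m × γ_n` is `κ_{m,n}(x; y)` itself; all other second order cumulants in
the formula have fewer arguments. -/
def cumulant₂ (m n : ℕ) (x : Fin m → A) (y : Fin n → A) : ℂ :=
  P.φ₂ (List.ofFn x).prod (List.ofFn y).prod -
    ∑ π ∈ annularNC m n, P.permCumulant π (Fin.append x y) -
    ∑ π : {π : Perm (Fin m) × Perm (Fin n) //
        (π.1 ∈ NC m ∧ π.2 ∈ NC n) ∧ π ≠ (finRotate m, finRotate n)},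
      ∑ i ∈ cycleMinima π.1.1, ∑ j ∈ cycleMinima π.1.2,
        cumulant₂ (cycleLength π.1.1 i) (cycleLength π.1.2 j)
            (cycleWord π.1.1 x i) (cycleWord π.1.2 y j) *
          P.unmarkedCumulant π.1.1 i x * P.unmarkedCumulant π.1.2 j y
termination_by m + n
decreasing_by
  have h₁ := cycleLength_le π.1.1 i
  have h₂ := cycleLength_le π.1.2 j
  by_cases h : π.1.1 = finRotate m
  · have h₃ := cycleLength_lt π.2.1.2 (fun h' => π.2.2 (Prod.ext h h')) j
    omega
  · have h₃ := cycleLength_lt π.2.1.1 h i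
    omega

/-- Second order freeness of a family of sets of random variables: all mixed first and second
order cumulants vanish. -/
structure SecondOrderFree {ι : Type*} (S : ι → Set A) : Prop where
  first : ∀ (n : ℕ) (s : Fin n → ι) (x : Fin n → A), (∀ i, x i ∈ S (s i)) →
    (∃ i i', s i ≠ s i') → P.cumulant n x = 0
  second : ∀ (m n : ℕ) (s : Fin m → ι) (t : Fin n → ι) (x : Fin m → A) (y : Fin n → A),
    (∀ i, x i ∈ S (s i)) → (∀ j, y j ∈ S (t j)) →
    (∃ k k', Fin.append s t k ≠ Fin.append s t k') → P.cumulant₂ m n x y = 0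

end SecondOrderProbabilitySpace

/-- A word in `a` and `a*`, given by a word in `true` (for `a`) and `false` (for `a*`). -/
def starWord {A : Type*} [Star A] (a : A) {n : ℕ} (ε : Fin n → Bool) : Fin n → A :=
  fun i => if ε i then a else star a

/-- A word of even length in two letters in which the letters alternate. -/
def Alternates {n : ℕ} (ε : Fin n → Bool) : Prop :=
  Even n ∧ ∀ i j : Fin n, (j : ℕ) = i + 1 → ε i ≠ ε j

/-- The word `a, a*, a, a*, …, a, a*` of length `2 * p`. -/
def altWord {A : Type*} [Star A] (a : A) (p : ℕ) : Fin (2 * p) → A :=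
  fun i => if Even (i : ℕ) then a else star a

namespace SecondOrderProbabilitySpace

variable {A : Type*} [Ring A] [Algebra ℂ A] [Star A] (P : SecondOrderProbabilitySpace A)

/-- `a` is `R`-diagonal: its only possibly non-vanishing `*`-cumulants are
`κ_{2l}(a, a*, …, a, a*)` and `κ_{2l}(a*, a, …, a*, a)`. -/
def IsRDiagonal (a : A) : Prop :=
  ∀ (n : ℕ) (ε : Fin n → Bool), ¬ Alternates ε → P.cumulant n (starWord a ε) = 0

/-- `a` is second order `R`-diagonal: it is `R`-diagonal, its second order `*`-cumulants vanish
unless both circles have an even number of entries and `a` and `a*` alternate on each circle, and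
`κ_{2p,2q}(a, a*, …, a, a*) = κ_{2p,2q}(a*, a, …, a*, a)`. -/
structure IsSecondOrderRDiagonal (a : A) : Prop where
  first : P.IsRDiagonal a
  second : ∀ (m n : ℕ) (ε : Fin m → Bool) (δ : Fin n → Bool), ¬ (Alternates ε ∧ Alternates δ) →
    P.cumulant₂ m n (starWord a ε) (starWord a δ) = 0
  second_eq : ∀ p q : ℕ, P.cumulant₂ (2 * p) (2 * q) (altWord a p) (altWord a q) =
    P.cumulant₂ (2 * p) (2 * q) (fun i => star (altWord a p i)) (fun j => star (altWord a q j))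

end SecondOrderProbabilitySpace

end

/-! Regard the letters as edges of a graph on two vertices, `true` and `false`: `a` runs from `true`
to `false`, `a*` runs back, and `b`, `b*` are loops at `false`. The hypotheses on `a` together with
freeness imply that a cumulant in these letters vanishes unless the word on each circle is a closed
path (`IsRCyclic`). Nothing is needed about the cumulants of `b` alone, because every word in loops
at one vertex is closed. The product `ab` is again an edge from `true` to `false`, and `(ab)* =
b*a*` is an edge from `false` to `true`. A word in these two edges is closed exactly when it
alternates. Hence it suffices that `R`-cyclicity survives adding products of composable edges
(`IsRCyclic.extend`).

That rests on formulas for cumulants with a product as entry, `kap_mul_cons` and `kap₂_mul_cons`.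
Taking the product `b * a` apart enlarges one circle by a point. By traciality the moment is
unchanged, so the moment-cumulant formulas for the two words can be compared. A permutation of the
enlarged circle is uniquely a permutation `π` of the old points, with the new point inserted into a
cycle, followed by a transposition of the new point with some point `k`. If `k` lies in the cycle of
the new point, this cycle is cut and planarity or annularity is that of `π`; otherwise two cycles
are joined, and a planar `π` on two circles becomes annular exactly when they lie on different
circles (`geodesic_insertAfter_iff`, `annular_insertAfter_iff`). By induction the contributions of
all smaller cumulants match, and the remaining top term is the formula: cut the cyclic word between
the two factors (`cutSum`, `cutSum₂`) or, in second order, insert the other circle there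
(`crossSum`). Each term in these formulas respects closed paths, because the two factors meet at a
common vertex.

The equality of the two alternating second order cumulants needs no hypothesis on `a` or `b`:
cumulants are invariant under rotating each circle, and exchanging a letter with its adjoint in an
alternating word of even length is a rotation. -/

noncomputable section

/-! ### Cycles of a permutation as lists -/

/-- The list `l` runs once around a cycle of `π`. -/
def IsCyc {Z : Type*} (π : Perm Z) (l : List Z) : Prop :=
  l ≠ [] ∧ l.Nodup ∧ l.map π = l.rotate 1

namespace IsCyc

variable {Z W : Type*} {π : Perm Z} {l l' : List Z}

theorem cons_iff {a : Z} {L : List Z} :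
    IsCyc π (a :: L) ↔ (a :: L).Nodup ∧ π a :: L.map π = L ++ [a] := by
  simp [IsCyc]

theorem rotate (h : IsCyc π l) (n : ℕ) : IsCyc π (l.rotate n) := by
  refine ⟨by simpa using h.1, by simpa using h.2.1, ?_⟩
  rw [List.map_rotate, h.2.2, List.rotate_rotate, List.rotate_rotate, add_comm]

theorem of_isRotated (h : IsCyc π l) (hr : l ~r l') : IsCyc π l' := by
  obtain ⟨n, rfl⟩ := hr
  exact h.rotate n

theorem map {π' : Perm W} (h : IsCyc π l) {f : Z → W} (hf : f.Injective)
    (hc : ∀ z ∈ l, π' (f z) = f (π z)) : IsCyc π' (l.map f) := by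
  refine ⟨by simpa using h.1, h.2.1.map hf, ?_⟩
  rw [← List.map_rotate, ← h.2.2, List.map_map, List.map_map]
  exact List.map_congr_left hc

theorem congr {π' : Perm Z} (h : IsCyc π l) (hc : ∀ z ∈ l, π' z = π z) : IsCyc π' l :=
  ⟨h.1, h.2.1, by rw [← h.2.2]; exact List.map_congr_left hc⟩

theorem apply_mem_iff (h : IsCyc π l) {i : Z} : π i ∈ l ↔ i ∈ l := by
  rw [← List.mem_rotate (n := 1), ← h.2.2]
  simp

/-- Once its first element is chosen, the list is determined by `π`. This is what makes cycles
unique up to rotation. -/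
theorem getElem_eq {a : Z} {L : List Z} (h : IsCyc π (a :: L)) (k : ℕ)
    (hk : k < (a :: L).length) : (a :: L)[k] = (π ^ k) a := by
  induction k with
  | zero => simp
  | succ k ih =>
    have h1 : ((a :: L).map π)[k]'(by simpa using Nat.lt_of_succ_lt hk) =
        ((a :: L).rotate 1)[k]'(by simpa using Nat.lt_of_succ_lt hk) := by
      simp only [h.2.2]
    rw [List.getElem_map, List.getElem_rotate, ih (Nat.lt_of_succ_lt hk)] at h1
    simp only [Nat.mod_eq_of_lt hk] at h1
    rw [← h1, pow_succ', Perm.mul_apply]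

theorem exists_cons (h : IsCyc π l) {a : Z} (ha : a ∈ l) :
    ∃ L, l ~r (a :: L) ∧ IsCyc π (a :: L) := by
  obtain ⟨u, v, rfl⟩ := List.append_of_mem ha
  have hr : u ++ a :: v ~r a :: (v ++ u) := by
    have := @List.isRotated_append _ u (a :: v)
    simpa using this
  exact ⟨_, hr, h.of_isRotated hr⟩

theorem sameCycle_iff (h : IsCyc π l) {i j : Z} (hi : i ∈ l) : π.SameCycle i j ↔ j ∈ l := by
  constructor
  · rintro ⟨n, rfl⟩
    have hp : ∀ (n : ℕ) (i : Z), (π ^ n) i ∈ l ↔ i ∈ l := by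
      intro n
      induction n with
      | zero => simp
      | succ n ih => intro i; rw [pow_succ', Perm.mul_apply, h.apply_mem_iff, ih]
    obtain ⟨m, rfl | rfl⟩ := n.eq_nat_or_neg
    · simpa [hp] using hi
    · rw [← hp m]; simpa using hi
  · intro hj
    obtain ⟨L, hr, hL⟩ := h.exists_cons hi
    obtain ⟨k, hk, rfl⟩ := List.getElem_of_mem (hr.mem_iff.mp hj)
    exact ⟨k, by rw [hL.getElem_eq]; simp⟩

theorem isRotated (h : IsCyc π l) (h' : IsCyc π l') {a : Z} (ha : a ∈ l) (ha' : a ∈ l') :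
    l ~r l' := by
  obtain ⟨L, hr, hL⟩ := h.exists_cons ha
  obtain ⟨L', hr', hL'⟩ := h'.exists_cons ha'
  suffices a :: L = a :: L' by rw [this] at hr; exact hr.trans hr'.symm
  -- Both lists enumerate the cycle of `a`, so they have the same length; their entries are then the
  -- same powers of `π` applied to `a`.
  have hp : (a :: L).Perm (a :: L') := by
    rw [List.perm_ext_iff_of_nodup hL.2.1 hL'.2.1]
    intro z
    rw [← hL.sameCycle_iff (i := a) (by simp), hL'.sameCycle_iff (by simp)]
  refine List.ext_getElem hp.length_eq fun k h1 h2 => ?_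
  rw [hL.getElem_eq, hL'.getElem_eq]

variable [DecidableEq Z]

/-- Multiplying by the transposition of two points of a cycle splits the cycle. -/
theorem split {a b : Z} {L M : List Z} (h : IsCyc π (a :: L ++ b :: M)) :
    IsCyc (swap a b * π) (a :: L) ∧ IsCyc (swap a b * π) (b :: M) := by
  rw [List.cons_append, cons_iff] at h
  obtain ⟨hn, hm⟩ := h
  have hn' : (a :: L).Nodup ∧ (b :: M).Nodup ∧ (a :: L).Disjoint (b :: M) := by
    rw [← List.cons_append] at hn
    exact List.nodup_append'.mp hn
  obtain ⟨n1, n2, n3⟩ := hn'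
  have e : (π a :: L.map π) ++ (π b :: M.map π) = (L ++ [b]) ++ (M ++ [a]) := by
    simpa using hm
  obtain ⟨e1, e2⟩ := List.append_inj e (by simp)
  have hsw : ∀ K : List Z, (∀ z ∈ K, z ≠ a ∧ z ≠ b) → K.map (swap a b) = K := by
    intro K hK
    conv_rhs => rw [← List.map_id K]
    exact List.map_congr_left fun z hz => swap_apply_of_ne_of_ne (hK z hz).1 (hK z hz).2
  have hL : L.map (swap a b) = L := hsw L fun z hz =>
    ⟨fun e => (List.nodup_cons.mp n1).1 (e ▸ hz),
      fun e => n3 (List.mem_cons_of_mem _ hz) (by simp [e])⟩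
  have hM : M.map (swap a b) = M := hsw M fun z hz =>
    ⟨fun e => n3 (a := z) (by simp [e]) (List.mem_cons_of_mem _ hz),
      fun e => (List.nodup_cons.mp n2).1 (e ▸ hz)⟩
  refine ⟨cons_iff.mpr ⟨n1, ?_⟩, cons_iff.mpr ⟨n2, ?_⟩⟩
  · have := congrArg (List.map (swap a b)) e1
    simpa [hL] using this
  · have := congrArg (List.map (swap a b)) e2
    simpa [hM] using this

/-- Multiplying by the transposition of points in two different cycles joins the cycles. -/
theorem join {a b : Z} {L M : List Z} (ha : IsCyc π (a :: L)) (hb : IsCyc π (b :: M))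
    (hd : (a :: L).Disjoint (b :: M)) : IsCyc (swap a b * π) (a :: L ++ b :: M) := by
  rw [cons_iff] at ha hb
  obtain ⟨n1, e1⟩ := ha
  obtain ⟨n2, e2⟩ := hb
  have hsw : ∀ K : List Z, (∀ z ∈ K, z ≠ a ∧ z ≠ b) → K.map (swap a b) = K := by
    intro K hK
    conv_rhs => rw [← List.map_id K]
    exact List.map_congr_left fun z hz => swap_apply_of_ne_of_ne (hK z hz).1 (hK z hz).2
  have hL : L.map (swap a b) = L := hsw L fun z hz =>
    ⟨fun e => (List.nodup_cons.mp n1).1 (e ▸ hz),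
      fun e => hd (List.mem_cons_of_mem _ hz) (by simp [e])⟩
  have hM : M.map (swap a b) = M := hsw M fun z hz =>
    ⟨fun e => hd (a := z) (by simp [e]) (List.mem_cons_of_mem _ hz),
      fun e => (List.nodup_cons.mp n2).1 (e ▸ hz)⟩
  rw [List.cons_append, cons_iff]
  refine ⟨by rw [← List.cons_append]; exact n1.append n2 hd, ?_⟩
  have e1' := congrArg (List.map (swap a b)) e1
  have e2' := congrArg (List.map (swap a b)) e2
  simp only [List.map_cons, List.map_map, List.map_append, hL, hM, swap_apply_left,
    swap_apply_right, List.map_nil] at e1' e2'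
  have := congrArg₂ (· ++ ·) e1' e2'
  simpa using this

theorem swap_mul {a b : Z} (h : IsCyc π l) (ha : a ∉ l) (hb : b ∉ l) :
    IsCyc (swap a b * π) l :=
  h.congr fun _ hz => swap_apply_of_ne_of_ne
    (fun e => ha (e ▸ h.apply_mem_iff.mpr hz)) (fun e => hb (e ▸ h.apply_mem_iff.mpr hz))

end IsCyc

/-- The cycle of `π` through `i`, starting with `i`. -/
def cycleList {Z : Type*} (π : Perm Z) (i : Z) : List Z :=
  List.ofFn fun k : Fin (Function.minimalPeriod π i) => (π ^ (k : ℕ)) i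

theorem isCyc_cycleList {Z : Type*} [Finite Z] (π : Perm Z) (i : Z) : IsCyc π (cycleList π i) := by
  have hpos : 0 < Function.minimalPeriod π i :=
    Function.minimalPeriod_pos_of_mem_periodicPts
      (Function.Injective.mem_periodicPts π.injective i)
  refine ⟨?_, ?_, ?_⟩
  · intro h
    have := congrArg List.length h
    simp [cycleList] at this
    omega
  · rw [cycleList, List.nodup_ofFn]
    intro k l hkl
    simp only [Perm.coe_pow] at hkl
    exact Fin.ext ((Function.iterate_eq_iterate_iff_of_lt_minimalPeriod k.2 l.2).mp hkl)
  · refine List.ext_getElem (by simp) fun k h1 h2 => ?_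
    simp only [cycleList, List.getElem_map, List.getElem_ofFn, List.getElem_rotate,
      List.length_ofFn]
    rw [← Perm.mul_apply, ← pow_succ', Perm.coe_pow, Perm.coe_pow,
      Function.iterate_mod_minimalPeriod_eq]

theorem mem_cycleList_self {Z : Type*} [Finite Z] (π : Perm Z) (i : Z) : i ∈ cycleList π i := by
  have hpos : 0 < Function.minimalPeriod π i :=
    Function.minimalPeriod_pos_of_mem_periodicPts
      (Function.Injective.mem_periodicPts π.injective i)
  rw [cycleList, List.mem_ofFn]
  exact ⟨⟨0, hpos⟩, by simp⟩

/-- `D` lists the cycles of `π`, fixed points included. -/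
structure IsDecomp {Z : Type*} (π : Perm Z) (D : List (List Z)) : Prop where
  isCyc : ∀ l ∈ D, IsCyc π l
  nodup : D.flatten.Nodup
  mem : ∀ z, z ∈ D.flatten

section Uniqueness

variable {Z : Type*} {π : Perm Z}

/-- The order of the cycles and their first elements are the only freedom in a decomposition. The
statement is about arbitrary lists of cycles covering the same points, so that the induction can
remove one cycle from each list. -/
theorem exists_perm_of_isCyc {D D' : List (List Z)}
    (h : ∀ l ∈ D, IsCyc π l) (h' : ∀ l ∈ D', IsCyc π l) (hn : D.flatten.Nodup)
    (hn' : D'.flatten.Nodup) (hm : ∀ z, z ∈ D.flatten ↔ z ∈ D'.flatten) :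
    ∃ D'', D''.Perm D' ∧ List.Forall₂ List.IsRotated D D'' := by
  induction D generalizing D' with
  | nil =>
    cases D' with
    | nil => exact ⟨[], by simp, by simp⟩
    | cons l D' =>
      obtain ⟨a, ha⟩ := List.exists_mem_of_ne_nil _ (h' l (by simp)).1
      have := (hm a).mpr (by simp [ha])
      simp at this
  | cons l D ih =>
    obtain ⟨a, ha⟩ := List.exists_mem_of_ne_nil _ (h l (by simp)).1
    obtain ⟨l', hl', ha'⟩ := List.mem_flatten.mp ((hm a).mp (by simp [ha]))
    have hr := (h l (by simp)).isRotated (h' l' hl') ha ha'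
    obtain ⟨u, v, rfl⟩ := List.append_of_mem hl'
    have hp : (u ++ l' :: v).Perm (l' :: (u ++ v)) := List.perm_middle
    have hnp := (hp.flatten.nodup_iff).mp hn'
    simp only [List.flatten_cons] at hn hnp
    rw [List.nodup_append'] at hn hnp
    obtain ⟨D'', hD'', hF⟩ := ih (D' := u ++ v) (fun l hl => h l (by simp [hl]))
      (fun l hl => h' l (hp.mem_iff.mpr (by simp only [List.mem_cons]; exact Or.inr hl)))
      hn.2.1 hnp.2.1 (by
        intro z
        have hz := hm z
        rw [hp.flatten.mem_iff] at hz
        simp only [List.flatten_cons, List.mem_append (s := l), List.mem_append (s := l')] at hz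
        have hz' := hr.mem_iff (a := z)
        have d1 : z ∈ l → z ∈ D.flatten → False := fun h1 h2 => hn.2.2 h1 h2
        have d2 : z ∈ l' → z ∈ (u ++ v).flatten → False := fun h1 h2 => hnp.2.2 h1 h2
        tauto)
    exact ⟨l' :: D'', (hD''.cons l').trans hp.symm, List.Forall₂.cons hr hF⟩

theorem IsDecomp.length_eq {D D' : List (List Z)} (h : IsDecomp π D) (h' : IsDecomp π D') :
    D.length = D'.length := by
  obtain ⟨D'', hp, hF⟩ := exists_perm_of_isCyc h.isCyc h'.isCyc h.nodup h'.nodup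
    (fun z => ⟨fun _ => h'.mem z, fun _ => h.mem z⟩)
  rw [hF.length_eq, hp.length_eq]

/-- A product along the cycles does not depend on the order of the cycles, nor on their first
elements if its factors do not. -/
theorem IsDecomp.prod_eq' {R : Type*} [CommMonoid R] {D D' : List (List Z)} (h : IsDecomp π D)
    (h' : IsDecomp π D') {f f' : List Z → R} (hf : ∀ l ∈ D, ∀ l', l ~r l' → f l = f' l') :
    (D.map f).prod = (D'.map f').prod := by
  obtain ⟨D'', hp, hF⟩ := exists_perm_of_isCyc h.isCyc h'.isCyc h.nodup h'.nodup
    (fun z => ⟨fun _ => h'.mem z, fun _ => h.mem z⟩)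
  rw [← (hp.map f').prod_eq]
  clear hp h h'
  induction hF with
  | nil => simp
  | cons hr _ ih =>
    simp only [List.map_cons, List.prod_cons]
    rw [hf _ (by simp) _ hr, ih fun l hl => hf l (by simp [hl])]

end Uniqueness

theorem isDecomp_of_transversal {Z : Type*} [Finite Z] {π : Perm Z} (T : Finset Z)
    (h : ∀ i, ∃ t ∈ T, π.SameCycle t i) (h' : ∀ s ∈ T, ∀ t ∈ T, π.SameCycle s t → s = t) :
    IsDecomp π (T.toList.map (cycleList π)) := by
  refine ⟨?_, ?_, ?_⟩
  · simp only [List.mem_map]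
    rintro _ ⟨t, -, rfl⟩
    exact isCyc_cycleList π t
  · rw [List.nodup_flatten]
    refine ⟨?_, ?_⟩
    · simp only [List.mem_map]
      rintro _ ⟨t, -, rfl⟩
      exact (isCyc_cycleList π t).2.1
    · rw [List.pairwise_map]
      refine (Finset.nodup_toList T).imp_of_mem ?_
      intro s t hs ht hst z hz hz'
      refine hst (h' s (by simpa using hs) t (by simpa using ht) ?_)
      exact (((isCyc_cycleList π s).sameCycle_iff (mem_cycleList_self π s)).mpr hz).trans
        (((isCyc_cycleList π t).sameCycle_iff (mem_cycleList_self π t)).mpr hz').symm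
  · intro z
    obtain ⟨t, ht, hz⟩ := h z
    rw [List.mem_flatten]
    exact ⟨cycleList π t, List.mem_map.mpr ⟨t, by simpa using ht, rfl⟩,
      ((isCyc_cycleList π t).sameCycle_iff (mem_cycleList_self π t)).mp hz⟩

theorem exists_isDecomp {Z : Type*} [Finite Z] (π : Perm Z) : ∃ D, IsDecomp π D := by
  classical
  have : Fintype Z := Fintype.ofFinite Z
  refine ⟨_, isDecomp_of_transversal (π := π)
    (univ.image fun i => (Quotient.mk (Perm.SameCycle.setoid π) i).out) ?_ ?_⟩
  · intro i
    exact ⟨_, Finset.mem_image_of_mem _ (Finset.mem_univ i),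
      Quotient.mk_out (s := Perm.SameCycle.setoid π) i⟩
  · simp only [Finset.mem_image, Finset.mem_univ, true_and]
    rintro _ ⟨i, rfl⟩ _ ⟨j, rfl⟩ hij
    congr 1
    refine Quotient.sound (s := Perm.SameCycle.setoid π) ?_
    exact ((Quotient.mk_out (s := Perm.SameCycle.setoid π) i).symm.trans hij).trans
      (Quotient.mk_out (s := Perm.SameCycle.setoid π) j)

theorem isDecomp_cycleMinima {n : ℕ} (π : Perm (Fin n)) :
    IsDecomp π ((cycleMinima π).toList.map (cycleList π)) := by
  classical
  refine isDecomp_of_transversal _ ?_ ?_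
  · intro i
    obtain ⟨j, hj, hmin⟩ := Finset.exists_min_image (univ.filter fun j => π.SameCycle i j) id
      ⟨i, by simp [Perm.SameCycle.refl]⟩
    simp only [Finset.mem_filter, Finset.mem_univ, true_and, id] at hj hmin
    exact ⟨j, by simpa [cycleMinima] using fun k hk => hmin k (hj.trans hk), hj.symm⟩
  · simp only [cycleMinima, Finset.mem_filter, Finset.mem_univ, true_and]
    exact fun s hs t ht hst => le_antisymm (hs t hst) (ht s hst.symm)

namespace IsDecomp

variable {Z W : Type*} {π : Perm Z} {D D' : List (List Z)}

theorem perm (h : IsDecomp π D) (hp : D.Perm D') : IsDecomp π D' :=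
  ⟨fun l hl => h.isCyc l (hp.mem_iff.mpr hl), hp.flatten.nodup_iff.mp h.nodup,
    fun z => hp.flatten.mem_iff.mp (h.mem z)⟩

theorem cons_isRotated {l l' : List Z} (h : IsDecomp π (l :: D)) (hr : l ~r l') :
    IsDecomp π (l' :: D) := by
  have hp : (l :: D).flatten.Perm (l' :: D).flatten := by
    simpa using hr.perm.append_right D.flatten
  refine ⟨?_, hp.nodup_iff.mp h.nodup, fun z => hp.mem_iff.mp (h.mem z)⟩
  intro l'' hl
  rcases List.mem_cons.mp hl with rfl | hl
  · exact (h.isCyc l (by simp)).of_isRotated hr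
  · exact h.isCyc _ (by simp [hl])

/-- Every point can be made the first point of the first cycle. -/
theorem exists_cons (h : IsDecomp π D) (a : Z) : ∃ L D', IsDecomp π ((a :: L) :: D') := by
  obtain ⟨l, hl, ha⟩ := List.mem_flatten.mp (h.mem a)
  obtain ⟨u, v, rfl⟩ := List.append_of_mem hl
  obtain ⟨L, hr, -⟩ := (h.isCyc l hl).exists_cons ha
  exact ⟨L, u ++ v, (h.perm List.perm_middle).cons_isRotated hr⟩

theorem exists_cons_cons (h : IsDecomp π D) {a b : Z} (hab : ¬ π.SameCycle a b) :
    ∃ L M D', IsDecomp π ((a :: L) :: (b :: M) :: D') := by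
  obtain ⟨L, D', h'⟩ := h.exists_cons a
  have hb : b ∈ D'.flatten := by
    have := h'.mem b
    rw [List.flatten_cons, List.mem_append] at this
    refine this.resolve_left fun hb => hab ?_
    exact ((h'.isCyc _ (by simp)).sameCycle_iff (by simp)).mpr hb
  obtain ⟨l, hl, hbl⟩ := List.mem_flatten.mp hb
  obtain ⟨u, v, rfl⟩ := List.append_of_mem hl
  have hp : ((a :: L) :: (u ++ l :: v)).Perm (l :: (a :: L) :: (u ++ v)) :=
    (List.perm_middle.cons _).trans (List.Perm.swap _ _ _)
  obtain ⟨M, hr, -⟩ := (h'.isCyc l (by simp)).exists_cons hbl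
  exact ⟨L, M, u ++ v, ((h'.perm hp).cons_isRotated hr).perm (List.Perm.swap _ _ _)⟩

theorem exists_cons_append (h : IsDecomp π D) {a b : Z} (hne : a ≠ b) (hab : π.SameCycle a b) :
    ∃ L M D', IsDecomp π ((a :: L ++ b :: M) :: D') := by
  obtain ⟨L, D', h'⟩ := h.exists_cons a
  have hb : b ∈ a :: L := ((h'.isCyc _ (by simp)).sameCycle_iff (by simp)).mp hab
  obtain ⟨u, v, huv⟩ := List.append_of_mem (List.mem_of_ne_of_mem hne.symm hb)
  exact ⟨u, v, D', by rw [List.cons_append, ← huv]; exact h'⟩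

theorem map_of_injective {π' : Perm W} (h : IsDecomp π D) {f : Z → W} (hf : f.Injective)
    (hs : f.Surjective) (hc : ∀ z, π' (f z) = f (π z)) : IsDecomp π' (D.map (List.map f)) := by
  refine ⟨?_, ?_, ?_⟩
  · simp only [List.mem_map]
    rintro _ ⟨l, hl, rfl⟩
    exact (h.isCyc l hl).map hf fun z _ => hc z
  · rw [← List.map_flatten]
    exact h.nodup.map hf
  · intro w
    obtain ⟨z, rfl⟩ := hs w
    rw [← List.map_flatten]
    exact List.mem_map_of_mem (h.mem z)

theorem optionCongr (h : IsDecomp π D) :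
    IsDecomp (optionCongr π) ([none] :: D.map (List.map some)) := by
  refine ⟨?_, ?_, ?_⟩
  · intro l hl
    rcases List.mem_cons.mp hl with rfl | hl
    · simp [IsCyc]
    · obtain ⟨l, hl', rfl⟩ := List.mem_map.mp hl
      exact (h.isCyc l hl').map (Option.some_injective _) fun z _ => by simp
  · rw [List.flatten_cons, ← List.map_flatten]
    simpa using h.nodup.map (Option.some_injective _)
  · rintro (_ | z)
    · simp
    · rw [List.flatten_cons, ← List.map_flatten, List.mem_append]
      exact Or.inr (List.mem_map_of_mem (h.mem z))

theorem sumCongr {τ : Perm W} {E : List (List W)} (h : IsDecomp π D) (h' : IsDecomp τ E) :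
    IsDecomp (Perm.sumCongr π τ) (D.map (List.map Sum.inl) ++ E.map (List.map Sum.inr)) := by
  refine ⟨?_, ?_, ?_⟩
  · intro l hl
    rcases List.mem_append.mp hl with hl | hl
    · obtain ⟨l, hl', rfl⟩ := List.mem_map.mp hl
      exact (h.isCyc l hl').map Sum.inl_injective fun z _ => by simp
    · obtain ⟨l, hl', rfl⟩ := List.mem_map.mp hl
      exact (h'.isCyc l hl').map Sum.inr_injective fun z _ => by simp
  · rw [List.flatten_append, ← List.map_flatten, ← List.map_flatten]
    refine (h.nodup.map Sum.inl_injective).append (h'.nodup.map Sum.inr_injective) ?_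
    intro z hz hz'
    obtain ⟨_, -, rfl⟩ := List.mem_map.mp hz
    obtain ⟨_, -, h⟩ := List.mem_map.mp hz'
    cases h
  · rw [List.flatten_append, ← List.map_flatten, ← List.map_flatten]
    rintro (z | z)
    · exact List.mem_append_left _ (List.mem_map_of_mem (h.mem z))
    · exact List.mem_append_right _ (List.mem_map_of_mem (h'.mem z))

theorem length_flatten [Fintype Z] (h : IsDecomp π D) : D.flatten.length = Fintype.card Z := by
  classical
  rw [← List.toFinset_card_of_nodup h.nodup, ← Finset.card_univ]
  congr 1
  ext z
  simpa using h.mem z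

theorem notMem_of_mem_tail {l l' : List Z} (h : IsDecomp π (l :: D)) (hl : l' ∈ D) {a : Z}
    (ha : a ∈ l) : a ∉ l' := by
  have := h.nodup
  rw [List.flatten_cons, List.nodup_append'] at this
  exact fun ha' => this.2.2 ha (List.mem_flatten.mpr ⟨l', hl, ha'⟩)

variable [DecidableEq Z]

theorem join {a b : Z} {L M : List Z} (h : IsDecomp π ((a :: L) :: (b :: M) :: D)) :
    IsDecomp (swap a b * π) ((a :: L ++ b :: M) :: D) := by
  have hf : ((a :: L) :: (b :: M) :: D).flatten = ((a :: L ++ b :: M) :: D).flatten := by simp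
  refine ⟨?_, hf ▸ h.nodup, fun z => hf ▸ h.mem z⟩
  intro l hl
  rcases List.mem_cons.mp hl with rfl | hl
  · exact (h.isCyc _ (by simp)).join (h.isCyc _ (by simp)) fun z hz hz' =>
      h.notMem_of_mem_tail (l' := b :: M) (by simp) hz hz'
  · exact (h.isCyc l (by simp [hl])).swap_mul (h.notMem_of_mem_tail (by simp [hl]) (by simp))
      ((h.perm (List.Perm.swap _ _ _)).notMem_of_mem_tail (by simp [hl]) (by simp))

theorem split {a b : Z} {L M : List Z} (h : IsDecomp π ((a :: L ++ b :: M) :: D)) :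
    IsDecomp (swap a b * π) ((a :: L) :: (b :: M) :: D) := by
  have hf : ((a :: L) :: (b :: M) :: D).flatten = ((a :: L ++ b :: M) :: D).flatten := by simp
  refine ⟨?_, hf ▸ h.nodup, fun z => hf ▸ h.mem z⟩
  intro l hl
  rcases List.mem_cons.mp hl with rfl | hl
  · exact (h.isCyc (a :: L ++ b :: M) (by simp)).split.1
  · rcases List.mem_cons.mp hl with rfl | hl
    · exact (h.isCyc (a :: L ++ b :: M) (by simp)).split.2
    · exact (h.isCyc l (by simp [hl])).swap_mul (h.notMem_of_mem_tail hl (by simp))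
        (h.notMem_of_mem_tail hl (by simp))

end IsDecomp

/-! ### The number of cycles -/

/-- A list of the cycles of `π`. -/
def cycles {Z : Type*} [Finite Z] (π : Perm Z) : List (List Z) := (exists_isDecomp π).choose

theorem isDecomp_cycles {Z : Type*} [Finite Z] (π : Perm Z) : IsDecomp π (cycles π) :=
  (exists_isDecomp π).choose_spec

/-- The number of cycles of `π`, fixed points included. -/
def ncyc {Z : Type*} [Finite Z] (π : Perm Z) : ℕ := (cycles π).length

section ncyc

variable {Z W : Type*} [Fintype Z] [Fintype W] {π γ : Perm Z}

theorem IsDecomp.length_eq_ncyc {D : List (List Z)} (h : IsDecomp π D) : D.length = ncyc π :=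
  h.length_eq (isDecomp_cycles π)

theorem ncyc_eq_of_equiv (e : Z ≃ W) {π' : Perm W} (hc : ∀ z, π' (e z) = e (π z)) :
    ncyc π' = ncyc π := by
  rw [← ((isDecomp_cycles π).map_of_injective e.injective e.surjective hc).length_eq_ncyc]
  simp [ncyc]

theorem ncyc_mul_comm (σ τ : Perm Z) : ncyc (σ * τ) = ncyc (τ * σ) :=
  ncyc_eq_of_equiv σ fun z => by simp

theorem ncyc_inv_mul (γ π : Perm Z) : ncyc (π⁻¹ * γ) = ncyc (γ * π⁻¹) :=
  ncyc_mul_comm _ _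

theorem ncyc_optionCongr (π : Perm Z) : ncyc (optionCongr π) = ncyc π + 1 := by
  rw [← (isDecomp_cycles π).optionCongr.length_eq_ncyc]
  simp [ncyc]

theorem ncyc_sumCongr (π : Perm Z) (τ : Perm W) :
    ncyc (Perm.sumCongr π τ) = ncyc π + ncyc τ := by
  rw [← ((isDecomp_cycles π).sumCongr (isDecomp_cycles τ)).length_eq_ncyc]
  simp [ncyc]

theorem ncyc_le_card (π : Perm Z) : ncyc π ≤ Fintype.card Z := by
  rw [← (isDecomp_cycles π).length_flatten, List.length_flatten, ncyc]
  have : ∀ D : List (List Z), (∀ l ∈ D, l ≠ []) → D.length ≤ (D.map List.length).sum := by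
    intro D hD
    induction D with
    | nil => simp
    | cons l D ih =>
      have h1 := List.length_pos_iff.mpr (hD l (by simp))
      have h2 := ih fun l hl => hD l (by simp [hl])
      simp only [List.length_cons, List.map_cons, List.sum_cons]
      omega
  exact this _ fun l hl => ((isDecomp_cycles π).isCyc l hl).1

theorem ncyc_one : ncyc (1 : Perm Z) = Fintype.card Z := by
  have h : IsDecomp (1 : Perm Z) ((univ : Finset Z).toList.map fun z => [z]) := by
    have hf : ((univ : Finset Z).toList.map fun z => [z]).flatten = univ.toList := by
      generalize (univ : Finset Z).toList = l
      induction l with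
      | nil => rfl
      | cons a l ih => simpa using ih
    refine ⟨?_, ?_, ?_⟩
    · simp only [List.mem_map]
      rintro _ ⟨z, -, rfl⟩
      simp [IsCyc]
    · rw [hf]
      exact Finset.nodup_toList _
    · rw [hf]
      simp
  rw [← h.length_eq_ncyc]
  simp

/-! ### Planar and annular permutations -/

/-- `π` lies on a geodesic from the identity to `γ`: `|γ| = |π| + |π⁻¹ γ|`. -/
def Geodesic (γ π : Perm Z) : Prop := ncyc π + ncyc (π⁻¹ * γ) = Fintype.card Z + ncyc γ

/-- The cycles of `π` are contained in cycles of `γ`. -/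
def Refines {Z : Type*} (π γ : Perm Z) : Prop := ∀ i, γ.SameCycle i (π i)

/-- Annular non-crossing permutations: some cycle of `π` meets different cycles of `γ`, and
`|γ| + 2 = |π| + |π⁻¹ γ|`. -/
def Annular (γ π : Perm Z) : Prop :=
  ¬ Refines π γ ∧ ncyc π + ncyc (π⁻¹ * γ) + 2 = Fintype.card Z + ncyc γ

theorem geodesic_self (γ : Perm Z) : Geodesic γ γ := by
  simp [Geodesic, ncyc_one, add_comm]

theorem Refines.sameCycle {Z : Type*} {π γ : Perm Z} (h : Refines π γ) {i j : Z} (hij : π.SameCycle i j) :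
    γ.SameCycle i j := by
  have hp : ∀ (n : ℕ) (i : Z), γ.SameCycle i ((π ^ n) i) := by
    intro n
    induction n with
    | zero => intro i; simp [Perm.SameCycle.refl]
    | succ n ih => intro i; rw [pow_succ', Perm.mul_apply]; exact (ih i).trans (h _)
  obtain ⟨n, rfl⟩ := hij
  obtain ⟨m, rfl | rfl⟩ := n.eq_nat_or_neg
  · exact_mod_cast hp m i
  · simpa using (hp m ((π ^ (-(m : ℤ))) i)).symm

theorem Refines.mul {Z : Type*} {γ : Perm Z} {σ τ : Perm Z} (h : Refines σ γ)
    (h' : Refines τ γ) : Refines (σ * τ) γ :=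
  fun i => (h' i).trans (h _)

variable [DecidableEq Z]

theorem ncyc_swap_mul_of_sameCycle {a b : Z} (hne : a ≠ b) (h : π.SameCycle a b) :
    ncyc (swap a b * π) = ncyc π + 1 := by
  obtain ⟨L, M, D, hD⟩ := (isDecomp_cycles π).exists_cons_append hne h
  rw [← hD.length_eq_ncyc, ← hD.split.length_eq_ncyc]
  simp

theorem ncyc_swap_mul_of_not_sameCycle {a b : Z} (h : ¬ π.SameCycle a b) :
    ncyc (swap a b * π) + 1 = ncyc π := by
  obtain ⟨L, M, D, hD⟩ := (isDecomp_cycles π).exists_cons_cons h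
  rw [← hD.length_eq_ncyc, ← hD.join.length_eq_ncyc]
  simp

theorem ncyc_swap_mul_le (a b : Z) (π : Perm Z) : ncyc (swap a b * π) ≤ ncyc π + 1 := by
  by_cases hne : a = b
  · rw [hne, swap_self]
    exact Nat.le_succ _
  by_cases h : π.SameCycle a b
  · rw [ncyc_swap_mul_of_sameCycle hne h]
  · have := ncyc_swap_mul_of_not_sameCycle h
    omega

/-- The triangle inequality for the length of permutations. -/
theorem ncyc_add_ncyc_le (σ τ : Perm Z) :
    ncyc σ + ncyc τ ≤ Fintype.card Z + ncyc (σ * τ) := by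
  induction hd : Fintype.card Z - ncyc σ using Nat.strong_induction_on generalizing σ with
  | _ d ih =>
    by_cases h1 : σ = 1
    · simp [h1, ncyc_one]
    obtain ⟨a, ha⟩ : ∃ a, σ a ≠ a := by
      by_contra! h
      exact h1 (Equiv.ext h)
    have hs := ncyc_swap_mul_of_sameCycle (π := σ) ha.symm ⟨1, by simp⟩
    have hle := ncyc_le_card (swap a (σ a) * σ)
    have := ih _ (by omega) (swap a (σ a) * σ) rfl
    have h2 := ncyc_swap_mul_le a (σ a) (σ * τ)
    rw [mul_assoc] at this
    omega

theorem refines_swap_iff {Z : Type*} [DecidableEq Z] {γ : Perm Z} {a b : Z} :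
    Refines (swap a b) γ ↔ γ.SameCycle a b := by
  refine ⟨fun h => by simpa using h a, fun h i => ?_⟩
  by_cases ha : i = a
  · simpa [ha] using h
  by_cases hb : i = b
  · simpa [hb] using h.symm
  · rw [swap_apply_of_ne_of_ne ha hb]

/-- If `i` and `π i` were in different cycles of `γ`, multiplying by their transposition would add a
cycle to `π` and remove one from `γ`, against the triangle inequality. -/
theorem Geodesic.refines (h : Geodesic γ π) : Refines π γ := by
  intro i
  by_cases hi : i = π i
  · rw [← hi]
  by_contra hγ
  have h1 := ncyc_swap_mul_of_sameCycle (π := π) hi ⟨1, by simp⟩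
  have h2 := ncyc_swap_mul_of_not_sameCycle hγ
  have h3 := ncyc_add_ncyc_le (swap i (π i) * π) (π⁻¹ * γ)
  rw [mul_assoc, mul_inv_cancel_left] at h3
  unfold Geodesic at h
  omega

end ncyc

/-! ### Products along cycles. -/

/-- Functions of lists which only depend on the list up to rotation. -/
def RotInv {Z R : Type*} (h : List Z → R) : Prop := ∀ l l', l ~r l' → h l = h l'

theorem RotInv.comp_map {Z W R : Type*} {h : List W → R} (hh : RotInv h) (f : Z → W) :
    RotInv fun l => h (l.map f) :=
  fun _ _ hr => hh _ _ (hr.map f)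

/-- The product of `h` along the cycles of `π`. -/
def cycProd {Z R : Type*} [Finite Z] [CommMonoid R] (π : Perm Z) (h : List Z → R) : R :=
  ((cycles π).map h).prod

theorem IsDecomp.prod_eq_cycProd {Z R : Type*} [Finite Z] [CommMonoid R] {π : Perm Z}
    {D : List (List Z)} (hD : IsDecomp π D) {h : List Z → R} (hh : RotInv h) :
    (D.map h).prod = cycProd π h :=
  hD.prod_eq' (isDecomp_cycles π) fun _ _ _ hr => hh _ _ hr

theorem cycProd_of_equiv {Z W R : Type*} [Finite Z] [Finite W] [CommMonoid R] (e : Z ≃ W)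
    {π : Perm Z} {π' : Perm W} (hc : ∀ z, π' (e z) = e (π z)) {h : List W → R} (hh : RotInv h) :
    cycProd π' h = cycProd π fun l => h (l.map e) := by
  rw [← ((isDecomp_cycles π).map_of_injective e.injective e.surjective hc).prod_eq_cycProd hh,
    List.map_map]
  rfl

/-! ### Inserting a point into a permutation -/

section Insert

variable {Z : Type*} [DecidableEq Z]

/-- The permutation `π` with the new point `none` inserted after `j`. -/
def insertAfter (π : Perm Z) (j : Z) : Perm (Option Z) := optionCongr π * swap none (some j)

theorem insertAfter_eq (π : Perm Z) (j : Z) :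
    insertAfter π j = swap none (some (π j)) * optionCongr π := by
  rw [insertAfter, mul_swap_eq_swap_mul]
  simp

theorem insertAfter_apply_some_self (π : Perm Z) (j : Z) : insertAfter π j (some j) = none := by
  simp [insertAfter]

theorem insertAfter_apply_none (π : Perm Z) (j : Z) : insertAfter π j none = some (π j) := by
  simp [insertAfter]

theorem insertAfter_apply_some (π : Perm Z) {j z : Z} (h : z ≠ j) :
    insertAfter π j (some z) = some (π z) := by
  simp [insertAfter, swap_apply_of_ne_of_ne, h]

/-- The list starts at the new point, so `j`, its predecessor, comes last. In words this turns `(b *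
a) :: L` into `a :: (L ++ [b])`. -/
theorem IsCyc.insertAfter_cons {π : Perm Z} {j : Z} {L : List Z} (h : IsCyc π (j :: L)) :
    IsCyc (insertAfter π j) (none :: (L ++ [j]).map some) := by
  have h1 := h.rotate 1
  have h2 : (j :: L).rotate 1 = π j :: L.map π := by rw [← h.2.2]; rfl
  have h3 : L ++ [j] = π j :: L.map π := by rw [← h2]; simp
  rw [h2] at h1
  rw [h3, insertAfter_eq]
  have h4 : IsCyc (optionCongr π) ((π j :: L.map π).map some) :=
    h1.map (Option.some_injective _) fun z _ => by simp
  have h5 : IsCyc (optionCongr π) ([none] : List (Option Z)) := by simp [IsCyc]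
  exact h5.join h4 (by simp)

theorem IsCyc.insertAfter_of_notMem {π : Perm Z} {j : Z} {l : List Z} (h : IsCyc π l)
    (hj : j ∉ l) : IsCyc (insertAfter π j) (l.map some) :=
  h.map (Option.some_injective _) fun _ hz =>
    insertAfter_apply_some π fun e => hj (e ▸ hz)

theorem IsDecomp.insertAfter {π : Perm Z} {j : Z} {L : List Z} {D : List (List Z)}
    (h : IsDecomp π ((j :: L) :: D)) :
    IsDecomp (insertAfter π j) ((none :: (L ++ [j]).map some) :: D.map (List.map some)) := by
  have hp : ((none :: (L ++ [j]).map some) :: D.map (List.map some)).flatten.Perm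
      (none :: ((j :: L) :: D).flatten.map some) := by
    simp only [List.flatten_cons, ← List.map_flatten, List.cons_append, List.map_append,
      List.map_cons, List.append_assoc, List.map_nil, List.nil_append]
    exact List.perm_middle.cons none
  refine ⟨?_, hp.nodup_iff.mpr ?_, fun z => hp.mem_iff.mpr ?_⟩
  · intro l hl
    rcases List.mem_cons.mp hl with rfl | hl
    · exact (h.isCyc _ (by simp)).insertAfter_cons
    · obtain ⟨l, hl', rfl⟩ := List.mem_map.mp hl
      exact (h.isCyc l (by simp [hl'])).insertAfter_of_notMem
        (h.notMem_of_mem_tail hl' (by simp))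
  · exact List.nodup_cons.mpr ⟨by simp, h.nodup.map (Option.some_injective _)⟩
  · cases z with
    | none => simp
    | some z => exact List.mem_cons_of_mem _ (List.mem_map_of_mem (h.mem z))

/-- The common transposition cancels. With the same insertion in `γ` and `π`, the complement merely
acquires a fixed point. -/
theorem insertAfter_mul_inv (γ π : Perm Z) (j : Z) :
    insertAfter γ j * (insertAfter π j)⁻¹ = optionCongr (γ * π⁻¹) := by
  rw [mul_inv_eq_iff_eq_mul, insertAfter, insertAfter, ← mul_assoc]
  congr 1
  ext z
  cases z <;> simp

variable [Fintype Z]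

/-- The new point belongs to the cycle of `j`; `getD j` collapses it onto `j`. -/
theorem sameCycle_insertAfter_iff {π : Perm Z} {j : Z} {a b : Option Z} :
    (insertAfter π j).SameCycle a b ↔ π.SameCycle (a.getD j) (b.getD j) := by
  by_cases ha : π.SameCycle j (a.getD j)
  · obtain ⟨L, D, hD⟩ := (isDecomp_cycles π).exists_cons j
    have h1 := hD.isCyc (j :: L) (by simp)
    have h2 := h1.insertAfter_cons
    have hm : ∀ c : Option Z, c ∈ none :: (L ++ [j]).map some ↔ c.getD j ∈ j :: L := by
      rintro (_ | c) <;> simp [or_comm]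
    rw [h2.sameCycle_iff, h1.sameCycle_iff, hm]
    · exact (h1.sameCycle_iff (by simp)).mp ha
    · exact (hm a).mpr ((h1.sameCycle_iff (by simp)).mp ha)
  · cases a with
    | none => exact absurd (Perm.SameCycle.refl _ _) ha
    | some a =>
      have h1 := isCyc_cycleList π a
      have hj : j ∉ cycleList π a := fun hj =>
        ha ((h1.sameCycle_iff (mem_cycleList_self π a)).mpr hj).symm
      have h2 := h1.insertAfter_of_notMem hj
      rw [h2.sameCycle_iff (List.mem_map_of_mem (mem_cycleList_self π a)), Option.getD_some,
        h1.sameCycle_iff (mem_cycleList_self π a)]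
      cases b with
      | none => simpa using hj
      | some b => simp

theorem ncyc_insertAfter (π : Perm Z) (j : Z) : ncyc (insertAfter π j) = ncyc π := by
  obtain ⟨L, D, hD⟩ := (isDecomp_cycles π).exists_cons j
  rw [← hD.length_eq_ncyc, ← hD.insertAfter.length_eq_ncyc]
  simp

theorem refines_insertAfter_iff {π γ : Perm Z} {j : Z} :
    Refines (insertAfter π j) (insertAfter γ j) ↔ Refines π γ := by
  simp only [Refines, sameCycle_insertAfter_iff]
  constructor
  · intro h i
    by_cases hi : i = j
    · subst hi; simpa [insertAfter_apply_none] using h none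
    · simpa [insertAfter_apply_some π hi] using h (some i)
  · rintro h (_ | i)
    · simpa [insertAfter_apply_none] using h j
    · by_cases hi : i = j
      · subst hi
        simp [insertAfter_apply_some_self, Perm.SameCycle.refl]
      · simpa [insertAfter_apply_some π hi] using h i

theorem ncyc_inv_mul_insertAfter_none (π γ : Perm Z) (j : Z) :
    ncyc ((insertAfter π j)⁻¹ * insertAfter γ j) = ncyc (π⁻¹ * γ) + 1 := by
  rw [ncyc_inv_mul, ncyc_inv_mul, ← ncyc_optionCongr, insertAfter_mul_inv]

/-- The transposition joins the fixed point `none` of the complement to another cycle, which undoes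
the extra cycle created by the insertion. -/
theorem ncyc_inv_mul_insertAfter_some (π γ : Perm Z) (j z : Z) :
    ncyc ((swap none (some z) * insertAfter π j)⁻¹ * insertAfter γ j) = ncyc (π⁻¹ * γ) := by
  have h : ncyc (swap none (some z) * optionCongr (γ * π⁻¹)) + 1 =
      ncyc (optionCongr (γ * π⁻¹)) := by
    refine ncyc_swap_mul_of_not_sameCycle ?_
    have h5 : IsCyc (optionCongr (γ * π⁻¹)) ([none] : List (Option Z)) := by simp [IsCyc]
    rw [h5.sameCycle_iff (by simp)]
    simp
  rw [ncyc_optionCongr, ← ncyc_inv_mul] at h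
  rw [← Nat.add_right_cancel h, ncyc_inv_mul, mul_inv_rev, swap_inv, ← mul_assoc,
    insertAfter_mul_inv, ncyc_mul_comm]

/-- The geodesic permutations for `γ` with a point inserted arise by cutting, in a geodesic
permutation for `γ` with this point inserted, the cycle of the new point. -/
theorem geodesic_insertAfter_iff {π γ : Perm Z} {j : Z} {k : Option Z} :
    Geodesic (insertAfter γ j) (swap none k * insertAfter π j) ↔
      Geodesic γ π ∧ (insertAfter π j).SameCycle none k := by
  simp only [Geodesic, ncyc_insertAfter, Fintype.card_option]
  cases k with
  | none =>
    rw [swap_self, ← Perm.one_def, one_mul, ncyc_insertAfter, ncyc_inv_mul_insertAfter_none]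
    simp only [Perm.SameCycle.refl, and_true]
    omega
  | some z =>
    rw [ncyc_inv_mul_insertAfter_some]
    by_cases h : (insertAfter π j).SameCycle none (some z)
    · rw [ncyc_swap_mul_of_sameCycle (by simp) h, ncyc_insertAfter]
      simp only [h, and_true]
      omega
    · have h1 := ncyc_swap_mul_of_not_sameCycle h
      -- Joining two cycles loses one cycle of the permutation, so a geodesic would force `π` to
      -- violate the triangle inequality.
      have h2 := ncyc_add_ncyc_le π (π⁻¹ * γ)
      rw [mul_inv_cancel_left] at h2
      rw [ncyc_insertAfter] at h1
      simp only [h, and_false, iff_false]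
      omega

/-- A cut preserves the defect from the geodesic equality, and a join raises it by two. So defect
two comes from cutting with defect two or from joining with defect zero; in the second case the
refinement condition selects the joins between different cycles of `γ`. -/
theorem annular_insertAfter_iff {π γ : Perm Z} {j : Z} {k : Option Z} :
    Annular (insertAfter γ j) (swap none k * insertAfter π j) ↔
      (Annular γ π ∧ (insertAfter π j).SameCycle none k) ∨
        (Geodesic γ π ∧ ¬ γ.SameCycle j (k.getD j)) := by
  have hj : (insertAfter γ j).SameCycle (some j) none := by
    simp [sameCycle_insertAfter_iff, Perm.SameCycle.refl]
  have hk : γ.SameCycle j (k.getD j) ↔ (insertAfter γ j).SameCycle none k := by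
    simp [sameCycle_insertAfter_iff]
  rw [hk]
  have hcut : Refines (swap none k) (insertAfter γ j) →
      (Refines (swap none k * insertAfter π j) (insertAfter γ j) ↔ Refines π γ) := by
    intro hs
    rw [← refines_insertAfter_iff (j := j)]
    refine ⟨fun h => ?_, fun h => hs.mul h⟩
    simpa [← mul_assoc] using hs.mul h
  rw [refines_swap_iff] at hcut
  by_cases h : (insertAfter π j).SameCycle none k
  · have hR : Refines (swap none k * insertAfter π j) (insertAfter γ j) ↔ Refines π γ := by
      refine ⟨fun hr => (hcut ?_).mp hr, fun hr => (hcut ?_).mpr hr⟩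
      -- The composite permutation sends `some j` to `k`, so refinement already places `k` in the
      -- cycle of the new point.
      · have := hr (some j)
        rw [Perm.mul_apply, insertAfter_apply_some_self, swap_apply_left] at this
        exact hj.symm.trans this
      · exact (refines_insertAfter_iff.mpr hr).sameCycle h
    have hG : ¬ (Geodesic γ π ∧ ¬ (insertAfter γ j).SameCycle none k) := fun hg =>
      hg.2 ((refines_insertAfter_iff.mpr hg.1.refines).sameCycle h)
    simp only [Annular, ncyc_insertAfter, Fintype.card_option, hR, h, and_true, hG, or_false]
    refine and_congr Iff.rfl ?_
    cases k with
    | none =>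
      rw [swap_self, ← Perm.one_def, one_mul, ncyc_insertAfter, ncyc_inv_mul_insertAfter_none]
      omega
    | some z =>
      rw [ncyc_inv_mul_insertAfter_some, ncyc_swap_mul_of_sameCycle (by simp) h,
        ncyc_insertAfter]
      omega
  · simp only [h, and_false, false_or]
    obtain _ | z := k
    · exact absurd (Perm.SameCycle.refl _ _) h
    have h1 := ncyc_swap_mul_of_not_sameCycle h
    rw [ncyc_insertAfter] at h1
    have hN : ncyc (swap none (some z) * insertAfter π j) +
        ncyc ((swap none (some z) * insertAfter π j)⁻¹ * insertAfter γ j) + 2 =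
          Fintype.card (Option Z) + ncyc (insertAfter γ j) ↔ Geodesic γ π := by
      rw [ncyc_inv_mul_insertAfter_some, ncyc_insertAfter, Fintype.card_option, Geodesic]
      omega
    rw [Annular, hN, and_comm]
    refine and_congr_right fun hg => not_congr ?_
    refine ⟨fun hr => ?_, fun hs => (hcut hs).mpr hg.refines⟩
    have := hr (some j)
    rw [Perm.mul_apply, insertAfter_apply_some_self, swap_apply_left] at this
    exact hj.symm.trans this

/-- Every permutation of `Option Z` is uniquely of the form `(none k) π̂`, where `π̂` is a
permutation of `Z` with the point `none` inserted after `j`. -/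
theorem sum_perm_option {M : Type*} [AddCommMonoid M] (j : Z) (F : Perm (Option Z) → M) :
    ∑ ρ, F ρ = ∑ π : Perm Z, ∑ k : Option Z, F (swap none k * insertAfter π j) := by
  rw [Finset.sum_comm, ← Finset.sum_product',
    -- Right multiplication by this transposition turns the standard decomposition `swap none k *
    -- optionCongr π` into the one with `insertAfter π j`.
    ← Equiv.sum_comp (Equiv.mulRight (swap none (some j))) F,
    ← (Perm.decomposeOption (α := Z)).symm.sum_comp]
  refine Finset.sum_congr (by simp) fun p _ => ?_
  simp [insertAfter, mul_assoc]

open scoped Classical in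
theorem sum_geodesic_insertAfter {M : Type*} [AddCommMonoid M] (γ : Perm Z) (j : Z)
    (F : Perm (Option Z) → M) :
    ∑ ρ with Geodesic (insertAfter γ j) ρ, F ρ =
      ∑ π with Geodesic γ π, ∑ k with (insertAfter π j).SameCycle none k,
        F (swap none k * insertAfter π j) := by
  rw [Finset.sum_filter, sum_perm_option j, Finset.sum_filter]
  refine Finset.sum_congr rfl fun π _ => ?_
  simp only [geodesic_insertAfter_iff, Finset.sum_filter]
  split_ifs with h <;> simp [h]

open scoped Classical in
theorem sum_annular_insertAfter {M : Type*} [AddCommMonoid M] (γ : Perm Z) (j : Z)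
    (F : Perm (Option Z) → M) :
    ∑ ρ with Annular (insertAfter γ j) ρ, F ρ =
      (∑ π with Annular γ π, ∑ k with (insertAfter π j).SameCycle none k,
        F (swap none k * insertAfter π j)) +
      ∑ π with Geodesic γ π, ∑ z with ¬ γ.SameCycle j z,
        F (swap none (some z) * insertAfter π j) := by
  rw [Finset.sum_filter, sum_perm_option j, Finset.sum_filter, Finset.sum_filter,
    ← Finset.sum_add_distrib]
  refine Finset.sum_congr rfl fun π _ => ?_
  have hna : Annular γ π → ¬ Geodesic γ π := fun h h' => h.1 h'.refines
  simp only [annular_insertAfter_iff, Finset.sum_filter]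
  by_cases h : Annular γ π
  · simp [h, hna h]
  · by_cases h' : Geodesic γ π
    · simp [h, h', Fintype.sum_option, Perm.SameCycle.refl]
    · simp [h, h']

theorem sum_list_eq_sum_range {M : Type*} [AddCommMonoid M] {α : Type*} (l : List α)
    (f : α → M) (g : ℕ → M) (h : ∀ t (ht : t < l.length), f l[t] = g t) :
    (l.map f).sum = ∑ t ∈ range l.length, g t := by
  rw [Finset.sum_range, ← Fin.sum_univ_fun_getElem]
  exact Finset.sum_congr rfl fun t _ => h t t.2

open scoped Classical in
/-- The sum over all ways of cutting the cycle of the inserted point. -/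
theorem sum_cut_cycProd {R : Type*} [CommSemiring R] {π : Perm Z} {j : Z} {L : List Z}
    {D : List (List Z)} (hD : IsDecomp π ((j :: L) :: D)) {h : List (Option Z) → R}
    (hh : RotInv h) :
    ∑ k with (insertAfter π j).SameCycle none k, cycProd (swap none k * insertAfter π j) h =
      (h (none :: (L ++ [j]).map some) +
        ∑ t ∈ range (L ++ [j]).length,
          h (none :: ((L ++ [j]).take t).map some) * h (((L ++ [j]).drop t).map some)) *
        (D.map fun l => h (l.map some)).prod := by
  have hD' := hD.insertAfter
  have hC := hD'.isCyc _ List.mem_cons_self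
  generalize L ++ [j] = M at *
  have hset : (univ.filter fun k => (insertAfter π j).SameCycle none k) =
      (none :: M.map some).toFinset := by
    ext k
    simp [hC.sameCycle_iff (i := none) (by simp)]
  rw [hset, List.sum_toFinset _ hC.2.1, List.map_cons, List.sum_cons, List.map_map, add_mul,
    Finset.sum_mul]
  congr 1
  -- The choice `k = none` is the trivial transposition and leaves the cycle whole; it gives the
  -- isolated first term.
  · rw [swap_self, ← Perm.one_def, one_mul, ← hD'.prod_eq_cycProd hh]
    simp [Function.comp_def]
  · refine sum_list_eq_sum_range _ _ _ fun t ht => ?_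
    have hM : M.map some = (M.take t).map some ++ some M[t] :: (M.drop (t + 1)).map some := by
      rw [← List.map_cons, ← List.drop_eq_getElem_cons, ← List.map_append, List.take_append_drop]
    rw [hM, ← List.cons_append] at hD'
    rw [Function.comp_apply, ← hD'.split.prod_eq_cycProd hh, List.drop_eq_getElem_cons ht]
    simp only [List.map_cons, List.prod_cons, List.map_map, mul_assoc, Function.comp_def]

/-- The sum over all ways of joining the cycle of the inserted point with another cycle. -/
theorem sum_join_cycProd {R : Type*} [CommSemiring R] {π : Perm Z} {j : Z} {L C : List Z}
    {D : List (List Z)} (hD : IsDecomp π ((j :: L) :: C :: D)) {h : List (Option Z) → R}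
    (hh : RotInv h) :
    (C.map fun z => cycProd (swap none (some z) * insertAfter π j) h).sum =
      (∑ t ∈ range C.length, h (none :: (L ++ [j]).map some ++ (C.rotate t).map some)) *
        (D.map fun l => h (l.map some)).prod := by
  have hD' := hD.insertAfter
  rw [Finset.sum_mul]
  refine sum_list_eq_sum_range _ _ _ fun t ht => ?_
  have hr : C.map some ~r some C[t] :: (C.drop (t + 1) ++ C.take t).map some := by
    rw [← List.map_cons, ← List.cons_append, ← List.drop_eq_getElem_cons,
      ← List.rotate_eq_drop_append_take ht.le]
    exact ⟨t, (List.map_rotate _ _ _).symm⟩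
  rw [List.map_cons] at hD'
  have := ((hD'.perm (List.Perm.swap _ _ _)).cons_isRotated hr).perm (List.Perm.swap _ _ _)
  rw [← this.join.prod_eq_cycProd hh, List.rotate_eq_drop_append_take ht.le,
    List.drop_eq_getElem_cons ht]
  simp only [List.map_cons, List.prod_cons, List.map_map, Function.comp_def, List.cons_append]

end Insert

/-! ### Transport along bijections -/

section Transport

variable {Z W : Type*} [Fintype Z] [Fintype W] {γ π : Perm Z} {γ' π' : Perm W}

theorem geodesic_iff_of_equiv (e : Z ≃ W) (hγ : ∀ z, γ' (e z) = e (γ z))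
    (hπ : ∀ z, π' (e z) = e (π z)) : Geodesic γ' π' ↔ Geodesic γ π := by
  have h : ∀ z, (π'⁻¹ * γ') (e z) = e ((π⁻¹ * γ) z) := by
    intro z
    rw [Perm.mul_apply, Perm.inv_eq_iff_eq, hπ, hγ]
    simp
  rw [Geodesic, Geodesic, ncyc_eq_of_equiv e hγ, ncyc_eq_of_equiv e hπ, ncyc_eq_of_equiv e h,
    Fintype.card_congr e]

theorem sameCycle_iff_of_equiv {Z W : Type*} [Fintype Z] {π : Perm Z} {π' : Perm W} (e : Z ≃ W)
    (hπ : ∀ z, π' (e z) = e (π z)) {i j : Z} :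
    π'.SameCycle (e i) (e j) ↔ π.SameCycle i j := by
  have h := (isCyc_cycleList π i).map (π' := π') e.injective fun z _ => hπ z
  rw [h.sameCycle_iff (List.mem_map_of_mem (mem_cycleList_self π i)),
    (isCyc_cycleList π i).sameCycle_iff (mem_cycleList_self π i)]
  simp

theorem refines_iff_of_equiv {Z W : Type*} [Fintype Z] {γ π : Perm Z} {γ' π' : Perm W}
    (e : Z ≃ W) (hγ : ∀ z, γ' (e z) = e (γ z))
    (hπ : ∀ z, π' (e z) = e (π z)) : Refines π' γ' ↔ Refines π γ := by
  simp only [Refines, e.surjective.forall, hπ, sameCycle_iff_of_equiv e hγ]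

theorem annular_iff_of_equiv (e : Z ≃ W) (hγ : ∀ z, γ' (e z) = e (γ z))
    (hπ : ∀ z, π' (e z) = e (π z)) : Annular γ' π' ↔ Annular γ π := by
  have h : ∀ z, (π'⁻¹ * γ') (e z) = e ((π⁻¹ * γ) z) := by
    intro z
    rw [Perm.mul_apply, Perm.inv_eq_iff_eq, hπ, hγ]
    simp
  rw [Annular, Annular, ncyc_eq_of_equiv e hγ, ncyc_eq_of_equiv e hπ, ncyc_eq_of_equiv e h,
    Fintype.card_congr e, refines_iff_of_equiv e hγ hπ]

variable {M : Type*} [AddCommMonoid M] [DecidableEq Z] [DecidableEq W]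

open scoped Classical in
theorem sum_geodesic_of_equiv (e : Z ≃ W) (hγ : ∀ z, γ' (e z) = e (γ z)) (F : Perm W → M) :
    ∑ π' with Geodesic γ' π', F π' = ∑ π with Geodesic γ π, F (e.permCongr π) := by
  refine (Finset.sum_equiv e.permCongr (fun π => ?_) fun _ _ => rfl).symm
  simp only [Finset.mem_filter, Finset.mem_univ, true_and]
  exact (geodesic_iff_of_equiv e hγ fun z => by simp).symm

open scoped Classical in
theorem sum_annular_of_equiv (e : Z ≃ W) (hγ : ∀ z, γ' (e z) = e (γ z)) (F : Perm W → M) :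
    ∑ π' with Annular γ' π', F π' = ∑ π with Annular γ π, F (e.permCongr π) := by
  refine (Finset.sum_equiv e.permCongr (fun π => ?_) fun _ _ => rfl).symm
  simp only [Finset.mem_filter, Finset.mem_univ, true_and]
  exact (annular_iff_of_equiv e hγ fun z => by simp).symm

end Transport

/-! ### Products along the cycles with one marked cycle -/

/-- The first order perturbation of `g` by `f`. The derivative of a product is the sum over the
choices of one factor, in which `g` is replaced by `f`. -/
def perturb {Z : Type*} (g f : List Z → ℂ) : List Z → DualNumber ℂ :=
  fun l => TrivSqZeroExt.inl (g l) + TrivSqZeroExt.inr (f l)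

theorem fst_perturb {Z : Type*} (g f : List Z → ℂ) (l : List Z) : (perturb g f l).fst = g l := by
  simp [perturb]

theorem snd_perturb {Z : Type*} (g f : List Z → ℂ) (l : List Z) : (perturb g f l).snd = f l := by
  simp [perturb]

theorem fst_prod_dual {ι : Type*} (s : Finset ι) (h : ι → DualNumber ℂ) :
    (∏ i ∈ s, h i).fst = ∏ i ∈ s, (h i).fst :=
  map_prod (TrivSqZeroExt.fstHom ℂ ℂ ℂ) h s

theorem snd_prod_dual {ι : Type*} [DecidableEq ι] (s : Finset ι) (h : ι → DualNumber ℂ) :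
    (∏ i ∈ s, h i).snd = ∑ i ∈ s, (h i).snd * ∏ j ∈ s.erase i, (h j).fst := by
  induction s using Finset.induction_on with
  | empty => simp
  | insert a s ha ih =>
    rw [Finset.prod_insert ha, TrivSqZeroExt.snd_mul, ih, Finset.sum_insert ha,
      Finset.erase_insert ha, fst_prod_dual]
    simp only [smul_eq_mul, MulOpposite.smul_eq_mul_unop, MulOpposite.unop_op]
    rw [add_comm, Finset.mul_sum]
    congr 1
    refine Finset.sum_congr rfl fun i hi => ?_
    have hne : a ≠ i := fun e => ha (e ▸ hi)
    rw [Finset.erase_insert_of_ne hne, Finset.prod_insert fun h' => ha (Finset.mem_of_mem_erase h')]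
    ring

/-- The product of `h` along the cycles of `π`, each starting with its least element. -/
def minProd {R : Type*} [CommMonoid R] {n : ℕ} (π : Perm (Fin n)) (h : List (Fin n) → R) : R :=
  ∏ i ∈ cycleMinima π, h (cycleList π i)

theorem minProd_eq_list {R : Type*} [CommMonoid R] {n : ℕ} (π : Perm (Fin n))
    (h : List (Fin n) → R) :
    minProd π h = (((cycleMinima π).toList.map (cycleList π)).map h).prod := by
  rw [List.map_map, Finset.prod_map_toList]
  rfl

theorem minProd_eq_cycProd {R : Type*} [CommMonoid R] {n : ℕ} (π : Perm (Fin n))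
    {h : List (Fin n) → R} (hh : RotInv h) : minProd π h = cycProd π h := by
  rw [minProd_eq_list, (isDecomp_cycleMinima π).prod_eq_cycProd hh]

/-- Conjugation does not respect least elements, so each image cycle is read only up to rotation.
The hypothesis compares values just on the cycles of `π`, so that an induction on word length can
provide it before rotation invariance is known in general. -/
theorem minProd_conj {R : Type*} [CommMonoid R] {n : ℕ} (e π : Perm (Fin n))
    {h h' : List (Fin n) → R}
    (hh : ∀ i ∈ cycleMinima π, ∀ l, (cycleList π i).map e ~r l → h (cycleList π i) = h' l) :
    minProd (e.permCongr π) h' = minProd π h := by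
  rw [minProd_eq_list, minProd_eq_list]
  symm
  have h1 := (isDecomp_cycleMinima π).map_of_injective (π' := e.permCongr π) e.injective
    e.surjective (by simp)
  rw [← h1.prod_eq' (isDecomp_cycleMinima (e.permCongr π)) (f := fun l => h (l.map e.symm)),
    List.map_map]
  · simp [Function.comp_def]
  · intro l hl l' hr
    simp only [List.mem_map] at hl
    obtain ⟨_, ⟨i, hi, rfl⟩, rfl⟩ := hl
    simpa using hh i (by simpa using hi) l' hr

theorem minProd_congr {R : Type*} [CommMonoid R] {n : ℕ} (π : Perm (Fin n))
    {h h' : List (Fin n) → R} (hh : ∀ i ∈ cycleMinima π, h (cycleList π i) = h' (cycleList π i)) :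
    minProd π h = minProd π h' :=
  Finset.prod_congr rfl hh

/-! ### The standard cycles -/

theorem val_finRotate_apply {n : ℕ} (k : Fin n) : (finRotate n k : ℕ) = (k + 1) % n := by
  cases n with
  | zero => exact k.elim0
  | succ n => rw [finRotate_apply, Fin.val_add, Fin.val_one', Nat.add_mod_mod]

theorem ofFn_comp_finRotate {A : Type*} {n : ℕ} (x : Fin n → A) :
    List.ofFn (x ∘ finRotate n) = (List.ofFn x).rotate 1 := by
  refine List.ext_getElem (by simp) fun k h1 h2 => ?_
  simp only [List.getElem_ofFn, List.getElem_rotate, List.length_ofFn, Function.comp_apply]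
  congr 1
  exact Fin.ext (val_finRotate_apply _)

theorem isCyc_finRotate {n : ℕ} (hn : n ≠ 0) : IsCyc (finRotate n) (List.ofFn id) := by
  refine ⟨by simpa using hn, List.nodup_ofFn.mpr Function.injective_id, ?_⟩
  rw [← ofFn_comp_finRotate, List.map_ofFn]
  rfl

theorem length_cycleList {n : ℕ} (π : Perm (Fin n)) (i : Fin n) :
    (cycleList π i).length = cycleLength π i := by
  simp [cycleList, cycleLength]

theorem cycleList_finRotate_zero (n : ℕ) : cycleList (finRotate (n + 1)) 0 = List.ofFn id := by
  have h1 := isCyc_finRotate (n := n + 1) (by simp)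
  have h2 := isCyc_cycleList (finRotate (n + 1)) 0
  have hl : (cycleList (finRotate (n + 1)) 0).length = n + 1 := by
    have hr := h1.isRotated h2 (a := 0) (by simp) (mem_cycleList_self _ _)
    simpa using hr.perm.length_eq.symm
  refine List.ext_getElem (by simpa using hl) fun k hk hk' => ?_
  rw [List.ofFn_succ] at h1
  have := h1.getElem_eq k (by simpa using hk')
  simp only [List.ofFn_succ]
  rw [this]
  simp [cycleList]

theorem cycleMinima_finRotate (n : ℕ) : cycleMinima (finRotate (n + 1)) = {0} := by
  have h1 := isCyc_finRotate (n := n + 1) (by simp)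
  have h : ∀ i j, (finRotate (n + 1)).SameCycle i j := fun i j =>
    (h1.sameCycle_iff (List.mem_ofFn.mpr ⟨i, rfl⟩)).mpr (List.mem_ofFn.mpr ⟨j, rfl⟩)
  ext i
  simp only [cycleMinima, h, Finset.mem_filter, Finset.mem_univ, true_and, true_imp_iff,
    Finset.mem_singleton]
  exact ⟨fun hi => le_antisymm (hi 0) (Fin.zero_le i), fun hi j => hi ▸ Fin.zero_le j⟩

theorem minProd_finRotate {R : Type*} [CommMonoid R] {n : ℕ} (hn : n ≠ 0)
    (h : List (Fin n) → R) : minProd (finRotate n) h = h (List.ofFn id) := by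
  obtain ⟨n, rfl⟩ := Nat.exists_eq_succ_of_ne_zero hn
  rw [minProd, cycleMinima_finRotate, Finset.prod_singleton, cycleList_finRotate_zero]

theorem permLength_add_ncyc {n : ℕ} (π : Perm (Fin n)) : permLength π + ncyc π = n := by
  have h := (isDecomp_cycleMinima π).length_eq_ncyc
  have h' := ncyc_le_card π
  simp only [List.length_map, Finset.length_toList, Fintype.card_fin] at h h'
  rw [permLength]
  omega

open scoped Classical in
theorem NC_eq_filter (n : ℕ) : NC n = univ.filter (Geodesic (finRotate n)) := by
  ext π
  have h1 := permLength_add_ncyc π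
  have h2 := permLength_add_ncyc (π⁻¹ * finRotate n)
  have h3 := permLength_add_ncyc (finRotate n)
  simp only [NC, Geodesic, Finset.mem_filter, Finset.mem_univ, true_and, Fintype.card_fin]
  omega

theorem annularRotate_finSumFinEquiv (m n : ℕ) (z : Fin m ⊕ Fin n) :
    annularRotate m n (finSumFinEquiv z) =
      finSumFinEquiv (Perm.sumCongr (finRotate m) (finRotate n) z) := by
  simp [annularRotate]

section sumCongr

variable {X Y : Type*} {σ : Perm X} {τ : Perm Y}

theorem sameCycle_sumCongr_inl [Finite X] {i : X} {z : X ⊕ Y} :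
    (Perm.sumCongr σ τ).SameCycle (Sum.inl i) z ↔ ∃ j, z = Sum.inl j ∧ σ.SameCycle i j := by
  have h := (isCyc_cycleList σ i).map (π' := Perm.sumCongr σ τ) (f := Sum.inl) Sum.inl_injective
    fun z _ => by simp
  rw [h.sameCycle_iff (List.mem_map_of_mem (mem_cycleList_self σ i)), List.mem_map]
  simp only [(isCyc_cycleList σ i).sameCycle_iff (mem_cycleList_self σ i)]
  exact ⟨fun ⟨j, h1, h2⟩ => ⟨j, h2.symm, h1⟩, fun ⟨j, h1, h2⟩ => ⟨j, h2, h1.symm⟩⟩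

theorem sameCycle_sumCongr_inr [Finite Y] {i : Y} {z : X ⊕ Y} :
    (Perm.sumCongr σ τ).SameCycle (Sum.inr i) z ↔ ∃ j, z = Sum.inr j ∧ τ.SameCycle i j := by
  have h := (isCyc_cycleList τ i).map (π' := Perm.sumCongr σ τ) (f := Sum.inr) Sum.inr_injective
    fun z _ => by simp
  rw [h.sameCycle_iff (List.mem_map_of_mem (mem_cycleList_self τ i)), List.mem_map]
  simp only [(isCyc_cycleList τ i).sameCycle_iff (mem_cycleList_self τ i)]
  exact ⟨fun ⟨j, h1, h2⟩ => ⟨j, h2.symm, h1⟩, fun ⟨j, h1, h2⟩ => ⟨j, h2, h1.symm⟩⟩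

end sumCongr

theorem sameCycle_finRotate {n : ℕ} (i j : Fin n) : (finRotate n).SameCycle i j := by
  rw [(isCyc_finRotate (n := n) (by have := i.2; omega)).sameCycle_iff] <;> simp

open scoped Classical in
-- The cycles of `annularRotate m n` are the two circles, so a cycle meeting both is the same as a
-- failure of refinement.
theorem annularNC_eq_filter (m n : ℕ) :
    annularNC m n = univ.filter (Annular (annularRotate m n)) := by
  ext π
  have h1 := permLength_add_ncyc π
  have h2 := permLength_add_ncyc (π⁻¹ * annularRotate m n)
  have h3 := permLength_add_ncyc (annularRotate m n)
  have hs : ∀ i j, (annularRotate m n).SameCycle (finSumFinEquiv i) (finSumFinEquiv j) ↔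
      (Perm.sumCongr (finRotate m) (finRotate n)).SameCycle i j := fun i j =>
    sameCycle_iff_of_equiv finSumFinEquiv (annularRotate_finSumFinEquiv m n)
  have hlr : ∀ (i : Fin m) (j : Fin n),
      ¬ (annularRotate m n).SameCycle (finSumFinEquiv (Sum.inl i)) (finSumFinEquiv (Sum.inr j)) := by
    intro i j
    rw [hs, sameCycle_sumCongr_inl]
    rintro ⟨_, h, -⟩
    cases h
  have hR : (∃ (i : Fin m) (j : Fin n), π.SameCycle (Fin.castAdd n i) (Fin.natAdd m j)) ↔
      ¬ Refines π (annularRotate m n) := by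
    constructor
    · rintro ⟨i, j, hij⟩ hr
      exact hlr i j (by simpa using hr.sameCycle hij)
    · intro hr
      simp only [Refines, not_forall] at hr
      obtain ⟨z, hz⟩ := hr
      have hπ : π.SameCycle z (π z) := ⟨1, by simp⟩
      obtain ⟨z, rfl⟩ := finSumFinEquiv.surjective z
      obtain ⟨w, hw⟩ := finSumFinEquiv.surjective (π (finSumFinEquiv z))
      rw [← hw] at hπ hz
      rw [hs] at hz
      rcases z with i | i <;> rcases w with j | j
      · exact absurd (sameCycle_sumCongr_inl.mpr ⟨j, rfl, sameCycle_finRotate _ _⟩) hz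
      · exact ⟨i, j, by simpa using hπ⟩
      · exact ⟨j, i, by simpa using hπ.symm⟩
      · exact absurd (sameCycle_sumCongr_inr.mpr ⟨j, rfl, sameCycle_finRotate _ _⟩) hz
  simp only [annularNC, Annular, Finset.mem_filter, Finset.mem_univ, true_and, Fintype.card_fin,
    hR]
  refine and_congr_right fun _ => ?_
  omega

theorem permCongr_apply_apply {Z W : Type*} (e : Z ≃ W) (π : Perm Z) (z : Z) :
    e.permCongr π (e z) = e (π z) := by
  simp

theorem rotInv_of_rotate_one {A R : Type*} {h : List A → R} (hh : ∀ l, h (l.rotate 1) = h l) :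
    RotInv h := by
  rintro l _ ⟨n, rfl⟩
  induction n with
  | zero => simp
  | succ n ih => rw [ih, ← List.rotate_rotate, hh]

/-- This carries the moment-cumulant formulas from the standard circle to any index type, in
particular to `Option`, where the inserted point needs no numerical position. -/
theorem IsCyc.exists_equiv {X : Type*} {γ : Perm X} {L : List X} (hL : IsCyc γ L)
    (hmem : ∀ z, z ∈ L) : ∃ e : Fin L.length ≃ X, (∀ k, γ (e k) = e (finRotate _ k)) ∧
      ∀ {A : Type*} (x : X → A), L.map x = List.ofFn (x ∘ e) := by
  classical
  let e : Fin L.length ≃ X := hL.2.1.getEquivOfForallMemList L hmem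
  have he : ∀ k, e k = L[k] := fun k => rfl
  refine ⟨e, ?_, fun x => List.ext_getElem (by simp) fun k h1 h2 => by simp [he]⟩
  rintro ⟨k, hk⟩
  have h1 : (L.map γ)[k]'(by simpa using hk) = (L.rotate 1)[k]'(by simpa using hk) := by
    simp only [hL.2.2]
  rw [List.getElem_rotate, List.getElem_map] at h1
  simpa only [he, Fin.getElem_fin, val_finRotate_apply] using h1

/-! ### Rotation invariance of first order cumulants and their moment formula. -/

namespace SecondOrderProbabilitySpace

variable {A : Type*} [Ring A] [Algebra ℂ A] (P : SecondOrderProbabilitySpace A)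

/-- The first order cumulant of the entries of a list. -/
def kap (l : List A) : ℂ := P.cumulant l.length l.get

/-- The second order cumulant of the entries of two lists. -/
def kap₂ (l r : List A) : ℂ := P.cumulant₂ l.length r.length l.get r.get

theorem cumulant_eq_kap {n : ℕ} (x : Fin n → A) : P.cumulant n x = P.kap (List.ofFn x) := by
  -- The length is made a variable so that the equality of lengths can be eliminated by
  -- substitution.
  have h : ∀ {m : ℕ} (e : m = n), P.cumulant m (x ∘ Fin.cast e) = P.cumulant n x := by
    rintro m rfl
    rfl
  rw [kap, ← h (List.length_ofFn (f := x))]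
  congr 1
  funext k
  simp [Fin.cast]

theorem cumulant₂_eq_kap₂ {m n : ℕ} (x : Fin m → A) (y : Fin n → A) :
    P.cumulant₂ m n x y = P.kap₂ (List.ofFn x) (List.ofFn y) := by
  have h : ∀ {m' n' : ℕ} (e : m' = m) (e' : n' = n),
      P.cumulant₂ m' n' (x ∘ Fin.cast e) (y ∘ Fin.cast e') = P.cumulant₂ m n x y := by
    rintro m' n' rfl rfl
    rfl
  rw [kap₂, ← h (List.length_ofFn (f := x)) (List.length_ofFn (f := y))]
  congr 1 <;> funext k <;> simp [Fin.cast]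

theorem cumulant_cycleWord {n : ℕ} (π : Perm (Fin n)) (x : Fin n → A) (i : Fin n) :
    P.cumulant (cycleLength π i) (cycleWord π x i) = P.kap ((cycleList π i).map x) := by
  rw [cumulant_eq_kap, cycleList, List.map_ofFn]
  rfl

theorem permCumulant_eq_minProd {n : ℕ} (π : Perm (Fin n)) (x : Fin n → A) :
    P.permCumulant π x = minProd π fun l => P.kap (l.map x) := by
  simp only [permCumulant, cumulant_cycleWord, minProd]

theorem kap_eq {n : ℕ} (x : Fin n → A) : P.kap (List.ofFn x) = P.φ (List.ofFn x).prod -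
    ∑ π ∈ (NC n).erase (finRotate n), minProd π fun l => P.kap (l.map x) := by
  classical
  rw [← cumulant_eq_kap, cumulant]
  congr 1
  rw [← Finset.sum_subtype ((NC n).erase (finRotate n)) (p := fun π => π ∈ NC n ∧ π ≠ finRotate n)
    (fun π => by rw [Finset.mem_erase, and_comm])
    (f := fun π => ∏ i ∈ cycleMinima π, P.cumulant (cycleLength π i) (cycleWord π x i))]
  exact Finset.sum_congr rfl fun π _ => P.permCumulant_eq_minProd π x

theorem moment_rotate (l : List A) : P.φ (l.rotate 1).prod = P.φ l.prod := by
  cases l with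
  | nil => rfl
  | cons a l => simp [P.φ_trace a]

theorem moment₂_rotate_left (l r : List A) : P.φ₂ (l.rotate 1).prod r.prod = P.φ₂ l.prod r.prod := by
  cases l with
  | nil => rfl
  | cons a l => simp [P.φ₂_trace_left a]

theorem finRotate_mem_NC (n : ℕ) : finRotate n ∈ NC n := by
  simp [NC_eq_filter, geodesic_self]

theorem conj_mem_NC_iff {n : ℕ} {π : Perm (Fin n)} :
    (finRotate n).symm.permCongr π ∈ NC n ↔ π ∈ NC n := by
  simp only [NC_eq_filter, Finset.mem_filter, Finset.mem_univ, true_and]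
  exact geodesic_iff_of_equiv (finRotate n).symm
    (fun z => by rw [apply_symm_apply, symm_apply_apply]) (permCongr_apply_apply _ π)

theorem conj_eq_finRotate_iff {n : ℕ} {π : Perm (Fin n)} :
    (finRotate n).symm.permCongr π = finRotate n ↔ π = finRotate n := by
  rw [← Equiv.eq_symm_apply]
  refine Eq.congr_right (Equiv.ext fun z => ?_)
  rw [permCongr_symm, symm_symm, permCongr_apply, apply_symm_apply]

/-- The moment is tracial and conjugation by the rotation permutes the non-crossing permutations.
All terms but the cumulant itself involve shorter words, for which invariance is known inductively.
-/
theorem kap_rotInv : RotInv P.kap := by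
  classical
  refine rotInv_of_rotate_one fun l => ?_
  induction hn : l.length using Nat.strong_induction_on generalizing l with
  | _ n ih =>
    have ih' : ∀ l l' : List A, l.length < n → l ~r l' → P.kap l = P.kap l' := by
      rintro l _ hl ⟨k, rfl⟩
      induction k with
      | zero => simp
      | succ k ihk => rw [ihk, ← List.rotate_rotate, ih _ (by simpa using hl) (l.rotate k) rfl]
    obtain ⟨x, rfl⟩ : ∃ x : Fin n → A, l = List.ofFn x := ⟨fun i => l.get (i.cast hn.symm), by
      subst hn; exact (List.ofFn_get l).symm⟩
    rw [← ofFn_comp_finRotate, kap_eq, ofFn_comp_finRotate, moment_rotate, P.kap_eq x]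
    congr 1
    symm
    refine Finset.sum_equiv (finRotate n).symm.permCongr (fun π => ?_) fun π hπ => ?_
    · rw [Finset.mem_erase, Finset.mem_erase, conj_mem_NC_iff, Ne, Ne, conj_eq_finRotate_iff]
    · obtain ⟨hne, hNC⟩ := Finset.mem_erase.mp hπ
      symm
      refine minProd_conj _ _ fun i _ l hr => ?_
      refine ih' _ _ ?_ ?_
      · rw [List.length_map, length_cycleList]
        exact cycleLength_lt hNC hne i
      · have := hr.map (x ∘ finRotate n)
        rw [List.map_map] at this
        convert this using 2
        funext z
        rw [Function.comp_apply, Function.comp_apply, apply_symm_apply]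

open scoped Classical in
/-- The first order moment-cumulant formula, for words indexed by any full cycle. -/
theorem moment_eq_sum {X : Type*} [Fintype X] [DecidableEq X] {γ : Perm X} {L : List X}
    (hL : IsCyc γ L) (hmem : ∀ z, z ∈ L) (x : X → A) :
    P.φ (L.map x).prod = ∑ π with Geodesic γ π, cycProd π fun l => P.kap (l.map x) := by
  classical
  obtain ⟨e, hγ, hx⟩ := hL.exists_equiv hmem
  have hn : L.length ≠ 0 := by simpa using hL.1
  have hinv := P.kap_rotInv.comp_map x
  have h1 := P.kap_eq (x ∘ e)
  rw [eq_sub_iff_add_eq'] at h1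
  have h2 : ∑ π with Geodesic γ π, cycProd π (fun l => P.kap (l.map x)) =
      ∑ π ∈ NC L.length, minProd π fun l => P.kap (l.map (x ∘ e)) := by
    have := sum_geodesic_of_equiv e hγ fun π => cycProd π fun l => P.kap (l.map x)
    rw [NC_eq_filter]
    refine this.trans (Finset.sum_congr rfl fun π _ => ?_)
    rw [cycProd_of_equiv e (permCongr_apply_apply e π) hinv, minProd_eq_cycProd _ (P.kap_rotInv.comp_map _)]
    simp
  rw [h2, hx x, ← h1, ← Finset.sum_erase_add _ _ (finRotate_mem_NC L.length),
    minProd_finRotate hn, List.map_ofFn]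
  rfl

end SecondOrderProbabilitySpace

theorem RotInv.perturb {Z : Type*} {g f : List Z → ℂ} (hg : RotInv g) (hf : RotInv f) :
    RotInv (perturb g f) := fun l l' hr => by
  rw [_root_.perturb, _root_.perturb, hg l l' hr, hf l l' hr]

theorem exists_eq_ofFn {A : Type*} (l : List A) : ∃ x : Fin l.length → A, l = List.ofFn x :=
  ⟨l.get, (List.ofFn_get l).symm⟩

/-! ### Symmetry and rotation invariance of second order cumulants and their moment formula. -/

namespace SecondOrderProbabilitySpace

variable {A : Type*} [Ring A] [Algebra ℂ A] (P : SecondOrderProbabilitySpace A)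

/-- The contribution of a pair of planar permutations with one marked cycle each to the second
order moment-cumulant formula, for cycles written starting with their least elements. -/
def pairMinSum {m n : ℕ} (π : Perm (Fin m)) (τ : Perm (Fin n)) (x : Fin m → A) (y : Fin n → A) :
    ℂ :=
  (minProd π (perturb (fun l => P.kap (l.map x)) fun l =>
    (minProd τ (perturb (fun r => P.kap (r.map y)) fun r =>
      P.kap₂ (l.map x) (r.map y))).snd)).snd

theorem snd_minProd_perturb {n : ℕ} (π : Perm (Fin n)) (g f : List (Fin n) → ℂ) :
    (minProd π (perturb g f)).snd = ∑ i ∈ cycleMinima π,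
      f (cycleList π i) * ∏ k ∈ (cycleMinima π).erase i, g (cycleList π k) := by
  simp only [minProd, snd_prod_dual, fst_perturb, snd_perturb]

theorem pairMinSum_eq {m n : ℕ} (π : Perm (Fin m)) (τ : Perm (Fin n)) (x : Fin m → A)
    (y : Fin n → A) : P.pairMinSum π τ x y = ∑ i ∈ cycleMinima π, ∑ j ∈ cycleMinima τ,
      P.kap₂ ((cycleList π i).map x) ((cycleList τ j).map y) *
        P.unmarkedCumulant π i x * P.unmarkedCumulant τ j y := by
  simp only [pairMinSum, snd_minProd_perturb, unmarkedCumulant, cumulant_cycleWord]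
  refine Finset.sum_congr rfl fun i _ => ?_
  rw [Finset.sum_mul]
  exact Finset.sum_congr rfl fun j _ => by ring

theorem kap₂_eq {m n : ℕ} (x : Fin m → A) (y : Fin n → A) :
    P.kap₂ (List.ofFn x) (List.ofFn y) = P.φ₂ (List.ofFn x).prod (List.ofFn y).prod -
      ∑ π ∈ annularNC m n, P.permCumulant π (Fin.append x y) -
      ∑ p ∈ (NC m ×ˢ NC n).erase (finRotate m, finRotate n), P.pairMinSum p.1 p.2 x y := by
  classical
  have hc : ∀ (π : Perm (Fin m)) (τ : Perm (Fin n)) (i : Fin m) (j : Fin n),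
      P.cumulant₂ (cycleLength π i) (cycleLength τ j) (cycleWord π x i) (cycleWord τ y j) =
        P.kap₂ ((cycleList π i).map x) ((cycleList τ j).map y) := by
    intro π τ i j
    rw [cumulant₂_eq_kap₂, cycleList, cycleList, List.map_ofFn, List.map_ofFn]
    rfl
  rw [← cumulant₂_eq_kap₂, cumulant₂]
  congr 1
  simp only [hc, pairMinSum_eq]
  exact (Finset.sum_subtype ((NC m ×ˢ NC n).erase (finRotate m, finRotate n))
    (p := fun π => (π.1 ∈ NC m ∧ π.2 ∈ NC n) ∧ π ≠ (finRotate m, finRotate n))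
    (fun π => by rw [Finset.mem_erase, Finset.mem_product, and_comm])
    (f := fun π => ∑ i ∈ cycleMinima π.1, ∑ j ∈ cycleMinima π.2,
      P.kap₂ ((cycleList π.1 i).map x) ((cycleList π.2 j).map y) *
        P.unmarkedCumulant π.1 i x * P.unmarkedCumulant π.2 j y)).symm

theorem length_cycleList_add_lt {m n : ℕ} {p : Perm (Fin m) × Perm (Fin n)}
    (hp : p ∈ (NC m ×ˢ NC n).erase (finRotate m, finRotate n)) (i : Fin m) (j : Fin n) :
    (cycleList p.1 i).length + (cycleList p.2 j).length < m + n := by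
  rw [Finset.mem_erase, Finset.mem_product] at hp
  rw [length_cycleList, length_cycleList]
  have h₁ := cycleLength_le p.1 i
  have h₂ := cycleLength_le p.2 j
  by_cases h : p.1 = finRotate m
  · have h₃ := cycleLength_lt hp.2.2 (fun h' => hp.1 (Prod.ext h h')) j
    omega
  · have h₃ := cycleLength_lt hp.2.1 h i
    omega

open scoped Classical in
/-- The contribution of the annular non-crossing permutations to the second order moment-cumulant
formula. -/
def annularSum {X Y : Type*} [Fintype X] [Fintype Y] (σ : Perm X) (τ : Perm Y) (x : X → A)
    (y : Y → A) : ℂ :=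
  ∑ π with Annular (Perm.sumCongr σ τ) π, cycProd π fun l => P.kap (l.map (Sum.elim x y))

theorem sum_annularNC {m n : ℕ} (x : Fin m → A) (y : Fin n → A) :
    ∑ π ∈ annularNC m n, P.permCumulant π (Fin.append x y) =
      P.annularSum (finRotate m) (finRotate n) x y := by
  classical
  have h := sum_annular_of_equiv finSumFinEquiv (annularRotate_finSumFinEquiv m n)
    fun π => P.permCumulant π (Fin.append x y)
  rw [annularNC_eq_filter, annularSum]
  refine h.trans (Finset.sum_congr (by ext; simp) fun π _ => ?_)
  rw [permCumulant_eq_minProd, minProd_eq_cycProd _ (P.kap_rotInv.comp_map _),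
    cycProd_of_equiv finSumFinEquiv (permCongr_apply_apply _ π) (P.kap_rotInv.comp_map _)]
  congr 1
  funext l
  rw [List.map_map]
  congr 2
  funext z
  rcases z with i | j <;> simp

theorem annularSum_of_equiv {X Y X' Y' : Type*} [Fintype X] [Fintype Y] [Fintype X'] [Fintype Y']
    {σ : Perm X} {τ : Perm Y} {σ' : Perm X'} {τ' : Perm Y'} (e : X ≃ X') (f : Y ≃ Y')
    (he : ∀ z, σ' (e z) = e (σ z)) (hf : ∀ z, τ' (f z) = f (τ z)) (x : X' → A) (y : Y' → A) :
    P.annularSum σ' τ' x y = P.annularSum σ τ (x ∘ e) (y ∘ f) := by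
  classical
  have h := sum_annular_of_equiv (γ := Perm.sumCongr σ τ) (γ' := Perm.sumCongr σ' τ')
    (Equiv.sumCongr e f) (by rintro (z | z) <;> simp [he, hf])
    fun π => cycProd π fun l => P.kap (l.map (Sum.elim x y))
  rw [annularSum, annularSum]
  convert h using 2 with π
  rw [cycProd_of_equiv (Equiv.sumCongr e f) (permCongr_apply_apply _ π) (P.kap_rotInv.comp_map _)]
  congr 1
  funext l
  rw [List.map_map]
  congr 2
  funext z
  rcases z with i | j <;> simp

theorem annularSum_comm {X Y : Type*} [Fintype X] [Fintype Y] (σ : Perm X) (τ : Perm Y)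
    (x : X → A) (y : Y → A) : P.annularSum σ τ x y = P.annularSum τ σ y x := by
  classical
  have h := sum_annular_of_equiv (γ := Perm.sumCongr τ σ) (γ' := Perm.sumCongr σ τ)
    (Equiv.sumComm Y X) (by rintro (z | z) <;> simp)
    fun π => cycProd π fun l => P.kap (l.map (Sum.elim x y))
  rw [annularSum, annularSum]
  convert h using 2 with π
  rw [cycProd_of_equiv (Equiv.sumComm Y X) (permCongr_apply_apply _ π) (P.kap_rotInv.comp_map _)]
  congr 1
  funext l
  rw [List.map_map]
  congr 2
  funext z
  rcases z with i | j <;> simp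

theorem kap₂_comm (l r : List A) : P.kap₂ l r = P.kap₂ r l := by
  induction hN : l.length + r.length using Nat.strong_induction_on generalizing l r with
  | _ N ih =>
    obtain ⟨m, x, rfl⟩ : ∃ m, ∃ x : Fin m → A, l = List.ofFn x := ⟨_, exists_eq_ofFn l⟩
    obtain ⟨n, y, rfl⟩ : ∃ n, ∃ y : Fin n → A, r = List.ofFn y := ⟨_, exists_eq_ofFn r⟩
    simp only [List.length_ofFn] at hN
    rw [kap₂_eq, kap₂_eq, sum_annularNC, sum_annularNC, P.annularSum_comm, P.φ₂_symm]
    congr 1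
    refine Finset.sum_equiv (Equiv.prodComm _ _) (fun p => ?_) fun p hp => ?_
    · simp only [Finset.mem_erase, Finset.mem_product, Equiv.prodComm_apply, Prod.fst_swap,
        Prod.snd_swap, ne_eq, Prod.ext_iff, and_comm]
    · rw [pairMinSum_eq, pairMinSum_eq, Finset.sum_comm]
      refine Finset.sum_congr rfl fun j _ => Finset.sum_congr rfl fun i _ => ?_
      have hlt := length_cycleList_add_lt hp i j
      rw [ih _ (by simpa [hN] using hlt) _ _ rfl]
      simp only [Equiv.prodComm_apply, Prod.fst_swap, Prod.snd_swap]
      ring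

theorem kap₂_rotate_left (l r : List A) : P.kap₂ (l.rotate 1) r = P.kap₂ l r := by
  induction hN : l.length + r.length using Nat.strong_induction_on generalizing l r with
  | _ N ih =>
    have ih' : ∀ l l' r : List A, l.length + r.length < N → l ~r l' → P.kap₂ l r = P.kap₂ l' r := by
      rintro l _ r hl ⟨k, rfl⟩
      induction k with
      | zero => simp
      | succ k ihk => rw [ihk, ← List.rotate_rotate, ih _ (by simpa using hl) (l.rotate k) r rfl]
    obtain ⟨m, x, rfl⟩ : ∃ m, ∃ x : Fin m → A, l = List.ofFn x := ⟨_, exists_eq_ofFn l⟩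
    obtain ⟨n, y, rfl⟩ : ∃ n, ∃ y : Fin n → A, r = List.ofFn y := ⟨_, exists_eq_ofFn r⟩
    simp only [List.length_ofFn] at hN
    have hA : P.annularSum (finRotate m) (finRotate n) x y =
        P.annularSum (finRotate m) (finRotate n) (x ∘ finRotate m) y :=
      P.annularSum_of_equiv (τ := finRotate n) (finRotate m) (Equiv.refl _) (fun _ => rfl) (fun _ => rfl) x y
    rw [← ofFn_comp_finRotate, kap₂_eq, ofFn_comp_finRotate, moment₂_rotate_left, P.kap₂_eq x,
      sum_annularNC, sum_annularNC, hA]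
    congr 1
    symm
    -- Only the first circle is rotated; the pair of full rotations is fixed by this bijection, so
    -- it can be removed on both sides.
    refine Finset.sum_equiv ((finRotate m).symm.permCongr.prodCongr (Equiv.refl _))
      (fun p => ?_) fun p hp => ?_
    · simp only [Finset.mem_erase, Finset.mem_product, Equiv.prodCongr_apply, Prod.map_fst,
        Prod.map_snd, conj_mem_NC_iff, ne_eq, Prod.ext_iff, conj_eq_finRotate_iff,
        Equiv.refl_apply]
    · have hx : ∀ l l' : List (Fin m), l.map (finRotate m).symm ~r l' →
          l.map x ~r l'.map (x ∘ finRotate m) := by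
        intro l l' hr
        have := hr.map (x ∘ finRotate m)
        rw [List.map_map] at this
        convert this using 2
        funext z
        rw [Function.comp_apply, Function.comp_apply, apply_symm_apply]
      symm
      rw [pairMinSum, pairMinSum]
      congr 1
      refine minProd_conj _ _ fun i _ l hr => ?_
      rw [perturb, perturb, P.kap_rotInv _ _ (hx _ _ hr)]
      congr 3
      refine minProd_congr _ fun j _ => ?_
      rw [perturb, perturb, ih' _ _ _ _ (hx _ _ hr)]
      rw [List.length_map, List.length_map, ← hN]
      exact length_cycleList_add_lt hp i j

theorem kap₂_rotInv_left (r : List A) : RotInv fun l => P.kap₂ l r :=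
  rotInv_of_rotate_one fun l => P.kap₂_rotate_left l r

theorem kap₂_rotInv_right (l : List A) : RotInv fun r => P.kap₂ l r := fun r r' hr => by
  simp only
  rw [kap₂_comm, P.kap₂_comm l]
  exact P.kap₂_rotInv_left l r r' hr

theorem kap₂_eq_of_isRotated {l l' r r' : List A} (hl : l ~r l') (hr : r ~r r') :
    P.kap₂ l r = P.kap₂ l' r' :=
  (P.kap₂_rotInv_left r _ _ hl).trans (P.kap₂_rotInv_right l' _ _ hr)

/-- The contribution of a permutation of the second circle with one marked cycle, when `G` is the
second order contribution of the marked cycles. -/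
def markedProd {Y : Type*} [Finite Y] (τ : Perm Y) (y : Y → A) (G : List Y → ℂ) : ℂ :=
  (cycProd τ (perturb (fun r => P.kap (r.map y)) G)).snd

theorem markedProd_of_equiv {Y Y' : Type*} [Finite Y] [Finite Y'] (e : Y ≃ Y') {τ : Perm Y}
    {τ' : Perm Y'} (he : ∀ z, τ' (e z) = e (τ z)) (y : Y' → A) {G : List Y' → ℂ}
    (hG : RotInv G) :
    P.markedProd τ' y G = P.markedProd τ (y ∘ e) fun r => G (r.map e) := by
  rw [markedProd, cycProd_of_equiv e he ((P.kap_rotInv.comp_map y).perturb hG), markedProd]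
  simp only [perturb, List.map_map]
  rfl

theorem markedProd_rotInv {X Y : Type*} [Finite Y] (τ : Perm Y) (x : X → A) (y : Y → A)
    {G : List A → List Y → ℂ} (hG : ∀ r, RotInv fun l => G l r) :
    RotInv fun l : List X => P.markedProd τ y fun r => G (l.map x) r := fun l l' hr => by
  have : ∀ r, G (l.map x) r = G (l'.map x) r := fun r => hG r _ _ (hr.map x)
  simp only [this]

theorem pairMinSum_eq_markedProd {m n : ℕ} (π : Perm (Fin m)) (τ : Perm (Fin n)) (x : Fin m → A)
    (y : Fin n → A) : P.pairMinSum π τ x y =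
      P.markedProd π x fun l => P.markedProd τ y fun r => P.kap₂ (l.map x) (r.map y) := by
  have h1 : ∀ l : List (Fin m), (minProd τ (perturb (fun r => P.kap (r.map y)) fun r =>
      P.kap₂ (l.map x) (r.map y))).snd = P.markedProd τ y fun r => P.kap₂ (l.map x) (r.map y) := by
    intro l
    rw [markedProd, minProd_eq_cycProd]
    exact (P.kap_rotInv.comp_map y).perturb ((P.kap₂_rotInv_right _).comp_map y)
  rw [pairMinSum, markedProd]
  simp only [h1]
  rw [minProd_eq_cycProd]
  exact (P.kap_rotInv.comp_map x).perturb
    (P.markedProd_rotInv τ x y fun r => P.kap₂_rotInv_left (r.map y))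

open scoped Classical in
/-- The second order moment-cumulant formula, for words indexed by any two full cycles. -/
theorem moment₂_eq_sum {X Y : Type*} [Fintype X] [Fintype Y] [DecidableEq X] [DecidableEq Y]
    {σ : Perm X} {τ : Perm Y} {L : List X} {R : List Y} (hL : IsCyc σ L) (hLm : ∀ z, z ∈ L) (hR : IsCyc τ R)
    (hRm : ∀ z, z ∈ R) (x : X → A) (y : Y → A) :
    P.φ₂ (L.map x).prod (R.map y).prod = P.annularSum σ τ x y +
      ∑ π with Geodesic σ π, ∑ ρ with Geodesic τ ρ,
        P.markedProd π x fun l => P.markedProd ρ y fun r => P.kap₂ (l.map x) (r.map y) := by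
  obtain ⟨e, he, hx⟩ := hL.exists_equiv hLm
  obtain ⟨f, hf, hy⟩ := hR.exists_equiv hRm
  have hm : L.length ≠ 0 := by simpa using hL.1
  have hn : R.length ≠ 0 := by simpa using hR.1
  have h1 := P.kap₂_eq (x ∘ e) (y ∘ f)
  rw [sum_annularNC, ← P.annularSum_of_equiv e f he hf, sub_sub, eq_sub_iff_add_eq'] at h1
  have h2 : (∑ π with Geodesic σ π, ∑ ρ with Geodesic τ ρ,
      P.markedProd π x fun l => P.markedProd ρ y fun r => P.kap₂ (l.map x) (r.map y)) =
      ∑ p ∈ NC L.length ×ˢ NC R.length, P.pairMinSum p.1 p.2 (x ∘ e) (y ∘ f) := by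
    rw [sum_geodesic_of_equiv e he, Finset.sum_product, NC_eq_filter, NC_eq_filter]
    refine Finset.sum_congr rfl fun π _ => ?_
    rw [sum_geodesic_of_equiv f hf]
    refine Finset.sum_congr rfl fun ρ _ => ?_
    rw [P.markedProd_of_equiv e (permCongr_apply_apply e π) x
      (P.markedProd_rotInv _ x y fun r => P.kap₂_rotInv_left (r.map y)), pairMinSum_eq_markedProd]
    congr 1
    funext l
    rw [P.markedProd_of_equiv f (permCongr_apply_apply f ρ) y
      ((P.kap₂_rotInv_right _).comp_map y)]
    simp only [List.map_map]
  have hmem : (finRotate L.length, finRotate R.length) ∈ NC L.length ×ˢ NC R.length :=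
    Finset.mem_product.mpr ⟨finRotate_mem_NC _, finRotate_mem_NC _⟩
  have htop : P.pairMinSum (finRotate L.length) (finRotate R.length) (x ∘ e) (y ∘ f) =
      P.kap₂ (List.ofFn (x ∘ e)) (List.ofFn (y ∘ f)) := by
    rw [pairMinSum, minProd_finRotate hm, snd_perturb, minProd_finRotate hn, snd_perturb,
      List.map_ofFn, List.map_ofFn]
    rfl
  rw [h2, hx x, hy y, ← h1, ← Finset.sum_erase_add _ _ hmem, htop]
  ring

end SecondOrderProbabilitySpace

/-! ### Words with a product of two letters -/

/-- The sum over all ways of cutting the cyclic word `a :: M` after `a`-initial segments. -/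
def cutSum {A R : Type*} [CommSemiring R] (h : List A → R) (a : A) (M : List A) : R :=
  h (a :: M) + ∑ t ∈ range M.length, h (a :: M.take t) * h (M.drop t)

section Words

variable {A R : Type*} [CommSemiring R] {h : List A → R} {X : Type*} [Fintype X] [DecidableEq X]
  {π : Perm X} {j : X} {K : List X} {D : List (List X)}

open scoped Classical in
theorem sum_cut_cycProd_map (hh : RotInv h) (hD : IsDecomp π ((j :: K) :: D)) (x : X → A)
    (a : A) :
    ∑ k with (insertAfter π j).SameCycle none k,
        cycProd (swap none k * insertAfter π j) (fun l => h (l.map fun k => k.elim a x)) =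
      cutSum h a (K.map x ++ [x j]) * (D.map fun l => h (l.map x)).prod := by
  rw [sum_cut_cycProd hD (hh.comp_map _), cutSum]
  have hM : K.map x ++ [x j] = (K ++ [j]).map x := by simp
  rw [hM, List.length_map]
  simp [Function.comp_def]

theorem cycProd_map_update (hh : RotInv h) (hD : IsDecomp π ((j :: K) :: D)) (x : X → A)
    (b : A) :
    cycProd π (fun l => h (l.map (Function.update x j b))) =
      h (b :: K.map x) * (D.map fun l => h (l.map x)).prod := by
  have hm : ∀ l : List X, j ∉ l → l.map (Function.update x j b) = l.map x := fun l hl =>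
    List.map_congr_left fun z hz => Function.update_of_ne (fun e => hl (by rwa [← e])) _ _
  rw [← hD.prod_eq_cycProd (hh.comp_map _), List.map_cons, List.prod_cons, List.map_cons,
    Function.update_self, hm K (List.nodup_cons.mp (hD.isCyc _ List.mem_cons_self).2.1).1]
  congr 2
  exact List.map_congr_left fun l hl => by
    rw [hm l (hD.notMem_of_mem_tail hl List.mem_cons_self)]

end Words

theorem map_insertAfter {A X : Type*} [DecidableEq X] {j : X} {γ : Perm X} {L : List X}
    (hL : IsCyc γ (j :: L)) (x : X → A)
    (b a : A) : (j :: L).map (Function.update x j b) = b :: L.map x ∧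
      (none :: (L ++ [j]).map some).map (fun k => Option.elim k a x) =
        a :: (L.map x ++ [x j]) := by
  have hj := (List.nodup_cons.mp hL.2.1).1
  refine ⟨?_, by simp [Function.comp_def]⟩
  rw [List.map_cons, Function.update_self]
  exact congrArg _ (List.map_congr_left fun z hz =>
    Function.update_of_ne (fun e => hj (by rwa [← e])) _ _)

/-! ### Cycles of geodesic permutations -/

theorem length_le_of_isCyc {n : ℕ} {π : Perm (Fin n)} {l : List (Fin n)} (hl : IsCyc π l) :
    l.length ≤ n := by
  simpa using hl.2.1.length_le_card

theorem length_lt_of_isCyc {n : ℕ} {π : Perm (Fin n)} (hπ : Geodesic (finRotate n) π)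
    (hne : π ≠ finRotate n) {l : List (Fin n)} (hl : IsCyc π l) : l.length < n := by
  classical
  obtain ⟨i, hi⟩ := List.exists_mem_of_ne_nil _ hl.1
  rw [(hl.isRotated (isCyc_cycleList π i) hi (mem_cycleList_self π i)).perm.length_eq,
    length_cycleList]
  exact cycleLength_lt (by simpa [NC_eq_filter] using hπ) hne i

theorem isDecomp_finRotate {n : ℕ} (hn : n ≠ 0) : IsDecomp (finRotate n) [List.ofFn id] :=
  ⟨by simpa using isCyc_finRotate hn, by simpa using (isCyc_finRotate hn).2.1,
    fun z => by rw [List.flatten_singleton]; exact List.mem_ofFn.mpr ⟨z, rfl⟩⟩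

theorem isCyc_finRotate_cons (m : ℕ) :
    IsCyc (finRotate (m + 1)) (0 :: List.ofFn Fin.succ) := by
  have := isCyc_finRotate (n := m + 1) (by simp)
  rwa [List.ofFn_succ] at this

theorem isDecomp_finRotate_cons (m : ℕ) :
    IsDecomp (finRotate (m + 1)) [0 :: List.ofFn Fin.succ] := by
  have := isDecomp_finRotate (n := m + 1) (by simp)
  rwa [List.ofFn_succ] at this

theorem mem_cons_ofFn_succ {m : ℕ} (i : Fin (m + 1)) :
    i ∈ (0 : Fin (m + 1)) :: List.ofFn Fin.succ := by
  simpa using (isDecomp_finRotate_cons m).mem i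

theorem mem_none_cons_ofFn_succ {m : ℕ} (i : Option (Fin (m + 1))) :
    i ∈ none :: (List.ofFn Fin.succ ++ [(0 : Fin (m + 1))]).map some := by
  cases i with
  | none => simp
  | some i =>
    have := mem_cons_ofFn_succ i
    simp only [List.mem_cons, List.mem_map, List.mem_append] at this ⊢
    exact Or.inr ⟨i, by tauto, rfl⟩

theorem exists_isDecomp_cons_of_geodesic {m : ℕ} {π : Perm (Fin (m + 1))}
    (hπ : Geodesic (finRotate (m + 1)) π) (hne : π ≠ finRotate (m + 1)) :
    ∃ K D, IsDecomp π ((0 :: K) :: D) ∧ K.length < m := by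
  obtain ⟨K, D, hD⟩ := (isDecomp_cycles π).exists_cons 0
  exact ⟨K, D, hD, by simpa using length_lt_of_isCyc hπ hne (hD.isCyc _ List.mem_cons_self)⟩

/-! ### First order cumulants with a product as entry. -/

namespace SecondOrderProbabilitySpace

variable {A : Type*} [Ring A] [Algebra ℂ A] (P : SecondOrderProbabilitySpace A)

/-- First order cumulants with a product as entry. -/
theorem kap_mul_cons (b a : A) (L : List A) :
    P.kap ((b * a) :: L) = cutSum P.kap a (L ++ [b]) := by
  classical
  induction hN : L.length using Nat.strong_induction_on generalizing L with
  | _ N ih =>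
    obtain ⟨m, z, rfl⟩ : ∃ m, ∃ z : Fin m → A, L = List.ofFn z := ⟨_, exists_eq_ofFn L⟩
    rw [List.length_ofFn] at hN
    subst hN
    let x : Fin (m + 1) → A := Fin.cons b z
    have hx0 : x 0 = b := rfl
    have hxs : (List.ofFn Fin.succ).map x = List.ofFn z := by
      rw [List.map_ofFn]
      rfl
    have hcyc := isCyc_finRotate_cons m
    obtain ⟨hw, hw'⟩ := map_insertAfter hcyc x (b * a) a
    have h1 := P.moment_eq_sum hcyc mem_cons_ofFn_succ (Function.update x 0 (b * a))
    have h2 := P.moment_eq_sum hcyc.insertAfter_cons mem_none_cons_ofFn_succ (fun k => k.elim a x)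
    rw [hw, hxs] at h1
    rw [hw', hxs, hx0] at h2
    -- Both words have the same moment: traciality moves `b` from the front to the end.
    have hφ : P.φ ((b * a) :: List.ofFn z).prod = P.φ (a :: (List.ofFn z ++ [b])).prod := by
      simp only [List.prod_cons, List.prod_append, List.prod_nil, mul_one]
      rw [mul_assoc, P.φ_trace b, mul_assoc]
    have h3 := sum_geodesic_insertAfter (finRotate (m + 1)) 0
      fun ρ => cycProd ρ fun l => P.kap (l.map fun k => k.elim a x)
    have h4 : ∑ π with Geodesic (finRotate (m + 1)) π,
        (cycProd π (fun l => P.kap (l.map (Function.update x 0 (b * a)))) -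
          ∑ k with (insertAfter π 0).SameCycle none k,
            cycProd (swap none k * insertAfter π 0) fun l => P.kap (l.map fun k => k.elim a x)) =
          0 := by
      rw [Finset.sum_sub_distrib, sub_eq_zero, ← h3]
      exact h1.symm.trans (hφ.trans h2)
    -- For every other `π` the cycle through the product is shorter, and the induction hypothesis
    -- makes its summand zero. The summand of the full cycle is the claim.
    rw [Finset.sum_eq_single (finRotate (m + 1))] at h4
    · have hD := isDecomp_finRotate_cons m
      rw [sum_cut_cycProd_map P.kap_rotInv hD, cycProd_map_update P.kap_rotInv hD, hxs,
        sub_eq_zero] at h4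
      simpa [hx0] using h4
    · intro π hπ hne
      obtain ⟨K, D, hD, hK⟩ :=
        exists_isDecomp_cons_of_geodesic (Finset.mem_filter.mp hπ).2 hne
      rw [sum_cut_cycProd_map P.kap_rotInv hD, cycProd_map_update P.kap_rotInv hD,
        ih _ (by simpa using hK) (K.map x) rfl, hx0, sub_self]
    · intro h
      exact absurd (Finset.mem_filter.mpr ⟨Finset.mem_univ _, geodesic_self _⟩) h

end SecondOrderProbabilitySpace

/-! ### Geodesic permutations of two circles -/

open scoped Classical in
-- A geodesic permutation refines the two circles, so it preserves each of them. The counts add, and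
-- equality in the sum of the two triangle inequalities forces equality in each.
theorem sum_geodesic_sumCongr {M X Y : Type*} [AddCommMonoid M] [Fintype X] [Fintype Y]
    [DecidableEq X] [DecidableEq Y] (σ : Perm X) (τ : Perm Y) (F : Perm (X ⊕ Y) → M) :
    ∑ π with Geodesic (Perm.sumCongr σ τ) π, F π =
      ∑ π with Geodesic σ π, ∑ ρ with Geodesic τ ρ, F (Perm.sumCongr π ρ) := by
  have hiff : ∀ (π : Perm X) (ρ : Perm Y),
      Geodesic (Perm.sumCongr σ τ) (Perm.sumCongr π ρ) ↔ Geodesic σ π ∧ Geodesic τ ρ := by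
    intro π ρ
    have h1 := ncyc_add_ncyc_le π (π⁻¹ * σ)
    have h2 := ncyc_add_ncyc_le ρ (ρ⁻¹ * τ)
    rw [mul_inv_cancel_left] at h1 h2
    simp only [Geodesic, Perm.sumCongr_inv, Perm.sumCongr_mul, ncyc_sumCongr, Fintype.card_sum]
    omega
  rw [← Finset.sum_product']
  symm
  refine Finset.sum_bij (fun p _ => Perm.sumCongr p.1 p.2) ?_ ?_ ?_ fun _ _ => rfl
  · intro p hp
    simpa [hiff] using hp
  · intro p _ q _ hpq
    exact Perm.sumCongrHom_injective hpq
  · intro π hπ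
    have hg : Geodesic (Perm.sumCongr σ τ) π := (Finset.mem_filter.mp hπ).2
    have hmaps : Set.MapsTo π (Set.range Sum.inl) (Set.range Sum.inl) := by
      rintro _ ⟨i, rfl⟩
      obtain ⟨j, hj, -⟩ := sameCycle_sumCongr_inl.mp (hg.refines (Sum.inl i))
      exact ⟨j, hj.symm⟩
    obtain ⟨p, rfl⟩ := Perm.mem_sumCongrHom_range_of_perm_mapsTo_inl hmaps
    refine ⟨p, ?_, rfl⟩
    simpa using (hiff p.1 p.2).mp hg

/-- The new point of the first circle as a new point of the disjoint union. -/
def optionSumEquiv (X Y : Type*) : Option X ⊕ Y ≃ Option (X ⊕ Y) where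
  toFun z := z.elim (Option.map Sum.inl) fun y => some (Sum.inr y)
  invFun z := z.elim (Sum.inl none) (Sum.map some id)
  left_inv := by rintro ((_ | x) | y) <;> rfl
  right_inv := by rintro (_ | x | y) <;> rfl

theorem insertAfter_sumCongr {X Y : Type*} [DecidableEq X] [DecidableEq Y] (σ : Perm X)
    (τ : Perm Y) (j : X) (z : Option X ⊕ Y) :
    insertAfter (Perm.sumCongr σ τ) (Sum.inl j) (optionSumEquiv X Y z) =
      optionSumEquiv X Y (Perm.sumCongr (insertAfter σ j) τ z) := by
  rcases z with (_ | x) | y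
  · simp [optionSumEquiv, insertAfter_apply_none]
  · by_cases hx : x = j
    · subst hx
      simp [optionSumEquiv, insertAfter_apply_some_self]
    · simp [optionSumEquiv, insertAfter_apply_some, hx]
  · simp [optionSumEquiv, insertAfter_apply_some]

/-- This is the product rule, in dual numbers. -/
theorem snd_prod_map_perturb {Z : Type*} (g f : List Z → ℂ) (D : List (List Z)) :
    (D.map (perturb g f)).prod.snd =
      ∑ i : Fin D.length, f D[i] * ((D.eraseIdx i).map g).prod := by
  have hfst : ∀ D : List (List Z), (D.map (perturb g f)).prod.fst = (D.map g).prod := by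
    intro D
    induction D with
    | nil => simp
    | cons l D ih => simp [ih, fst_perturb]
  induction D with
  | nil => simp
  | cons l D ih =>
    rw [List.map_cons, List.prod_cons, TrivSqZeroExt.snd_mul, ih, hfst, fst_perturb, snd_perturb]
    refine Eq.trans ?_ (Fin.sum_univ_succ _).symm
    simp only [smul_eq_mul, MulOpposite.smul_eq_mul_unop, MulOpposite.unop_op, Finset.mul_sum]
    rw [add_comm]
    congr 1
    refine Finset.sum_congr rfl fun i _ => ?_
    simp only [Fin.getElem_fin, Fin.val_succ, List.getElem_cons_succ, List.eraseIdx_cons_succ,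
      List.map_cons, List.prod_cons]
    ring

/-- The derivative of `cutSum` at `g` in the direction `f`. -/
def cutSum₂ {A : Type*} (g f : List A → ℂ) (a : A) (M : List A) : ℂ :=
  f (a :: M) + ∑ t ∈ range M.length,
    (f (a :: M.take t) * g (M.drop t) + g (a :: M.take t) * f (M.drop t))

theorem fst_cutSum_perturb {A : Type*} (g f : List A → ℂ) (a : A) (M : List A) :
    (cutSum (perturb g f) a M).fst = cutSum g a M := by
  have h := map_sum (TrivSqZeroExt.fstHom ℂ ℂ ℂ)
    (fun t => perturb g f (a :: M.take t) * perturb g f (M.drop t)) (range M.length)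
  simp only [TrivSqZeroExt.fstHom_apply] at h
  simp [cutSum, h, fst_perturb]

theorem snd_cutSum_perturb {A : Type*} (g f : List A → ℂ) (a : A) (M : List A) :
    (cutSum (perturb g f) a M).snd = cutSum₂ g f a M := by
  have h := map_sum (TrivSqZeroExt.sndHom ℂ ℂ)
    (fun t => perturb g f (a :: M.take t) * perturb g f (M.drop t)) (range M.length)
  simp only [TrivSqZeroExt.sndHom_apply] at h
  simp only [cutSum, TrivSqZeroExt.snd_add, h, snd_perturb, TrivSqZeroExt.snd_mul, fst_perturb,
    cutSum₂, smul_eq_mul, MulOpposite.smul_eq_mul_unop, MulOpposite.unop_op]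
  congr 1
  exact Finset.sum_congr rfl fun t _ => by ring

/-- Linearity in the direction lets the sum over marked cycles of the second circle be pulled out of
the cuts. -/
theorem cutSum₂_sum {A ι : Type*} [Fintype ι] (g : List A → ℂ) (f : ι → List A → ℂ) (c : ι → ℂ)
    (a : A) (M : List A) :
    cutSum₂ g (fun l => ∑ i, f i l * c i) a M = ∑ i, cutSum₂ g (f i) a M * c i := by
  simp only [cutSum₂, add_mul, Finset.sum_add_distrib, Finset.sum_mul, Finset.mul_sum]
  rw [Finset.sum_comm (s := univ), Finset.sum_comm (s := univ)]
  congr 2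
  · exact Finset.sum_congr rfl fun t _ => Finset.sum_congr rfl fun i _ => by ring
  · exact Finset.sum_congr rfl fun t _ => Finset.sum_congr rfl fun i _ => by ring

namespace SecondOrderProbabilitySpace

variable {A : Type*} [Ring A] [Algebra ℂ A] (P : SecondOrderProbabilitySpace A)

/-- The sum over all ways of inserting the cyclic word `r` into the cyclic word `a :: M` after
`M`. -/
def crossSum (a : A) (M r : List A) : ℂ :=
  ∑ t ∈ range r.length, P.kap (a :: M ++ r.rotate t)

theorem markedProd_eq_sum {Y : Type*} [Finite Y] {τ : Perm Y} {E : List (List Y)}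
    (hE : IsDecomp τ E) (y : Y → A) {G : List Y → ℂ} (hG : RotInv G) :
    P.markedProd τ y G =
      ∑ i : Fin E.length, G E[i] * ((E.eraseIdx i).map fun r => P.kap (r.map y)).prod := by
  rw [markedProd, ← hE.prod_eq_cycProd ((P.kap_rotInv.comp_map y).perturb hG),
    snd_prod_map_perturb]

/-- The error in the formula for the second order cumulants with a product as entry. -/
def mulDefect (b a : A) (L r : List A) : ℂ :=
  P.kap₂ ((b * a) :: L) r - cutSum₂ P.kap (fun l => P.kap₂ l r) a (L ++ [b]) -
    P.crossSum a (L ++ [b]) r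

open scoped Classical in
/-- The annular contributions for a word with a product of two letters, and for the word with these
letters taken apart. -/
theorem annularSum_insertAfter {X Y : Type*} [Fintype X] [Fintype Y] [DecidableEq X]
    [DecidableEq Y] {σ : Perm X} {τ : Perm Y}
    (j : X) (hσ : ∀ i, σ.SameCycle j i) (x : X → A) (y : Y → A) (a : A) :
    P.annularSum (insertAfter σ j) τ (fun k => Option.elim k a x) y =
      P.annularSum σ τ (Function.update x j (x j * a)) y +
        ∑ π with Geodesic σ π, ∑ ρ with Geodesic τ ρ, ∑ z : Y,
          cycProd (swap none (some (Sum.inr z)) * insertAfter (Perm.sumCongr π ρ) (Sum.inl j))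
            fun l => P.kap (l.map fun k => Option.elim k a (Sum.elim x y)) := by
  have h1 := sum_annular_of_equiv (γ := Perm.sumCongr (insertAfter σ j) τ)
    (γ' := insertAfter (Perm.sumCongr σ τ) (Sum.inl j)) (optionSumEquiv X Y)
    (insertAfter_sumCongr σ τ j)
    fun π => cycProd π fun l => P.kap (l.map fun k => Option.elim k a (Sum.elim x y))
  have h2 : P.annularSum (insertAfter σ j) τ (fun k => Option.elim k a x) y =
      ∑ π with Annular (insertAfter (Perm.sumCongr σ τ) (Sum.inl j)) π,
        cycProd π fun l => P.kap (l.map fun k => Option.elim k a (Sum.elim x y)) := by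
    refine Eq.trans ?_ h1.symm
    rw [annularSum]
    refine Finset.sum_congr (by ext; simp) fun π _ => ?_
    rw [cycProd_of_equiv (optionSumEquiv X Y) (permCongr_apply_apply _ π)
      (P.kap_rotInv.comp_map _)]
    congr 1
    funext l
    rw [List.map_map]
    congr 2
    funext z
    rcases z with (_ | i) | i <;> rfl
  have h3 := sum_annular_insertAfter (Perm.sumCongr σ τ) (Sum.inl j)
    fun π => cycProd π fun l => P.kap (l.map fun k => Option.elim k a (Sum.elim x y))
  rw [h2]
  refine Eq.trans (Finset.sum_congr (by ext; simp) fun _ _ => rfl) (h3.trans ?_)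
  congr 1
  · rw [annularSum]
    refine Finset.sum_congr (by ext; simp) fun π _ => ?_
    obtain ⟨K, D, hD⟩ := (isDecomp_cycles π).exists_cons (Sum.inl j)
    have hu : Sum.elim (Function.update x j (x j * a)) y =
        Function.update (Sum.elim x y) (Sum.inl j) (Sum.elim x y (Sum.inl j) * a) := by
      rw [← Sum.update_elim_inl]
      rfl
    -- Annular permutations contribute only first order cumulants, so the first order product
    -- formula matches their cuts exactly.
    rw [hu, cycProd_map_update P.kap_rotInv hD, kap_mul_cons,
      ← sum_cut_cycProd_map P.kap_rotInv hD]
  · refine Eq.trans ?_ (sum_geodesic_sumCongr σ τ fun π => ∑ z : Y,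
          cycProd (swap none (some (Sum.inr z)) * insertAfter π (Sum.inl j))
            fun l => P.kap (l.map fun k => Option.elim k a (Sum.elim x y)))
    refine Finset.sum_congr (by ext; simp) fun π _ => ?_
    -- The whole first circle is one cycle of `σ`, so the joins that change circles are those with a
    -- point of `Y`.
    have hset : (univ.filter fun z : X ⊕ Y => ¬ (Perm.sumCongr σ τ).SameCycle (Sum.inl j) z) =
        univ.map ⟨Sum.inr, Sum.inr_injective⟩ := by
      ext z
      simp only [Finset.mem_filter, Finset.mem_univ, true_and, Finset.mem_map,
        Function.Embedding.coeFn_mk, sameCycle_sumCongr_inl]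
      rcases z with i | i
      · simp [hσ]
      · simp
    refine Eq.trans (Finset.sum_congr ?_ fun _ _ => rfl) (Finset.sum_map univ
      ⟨Sum.inr, Sum.inr_injective⟩ fun z => cycProd (swap none (some z) * insertAfter π (Sum.inl j))
            fun l => P.kap (l.map fun k => Option.elim k a (Sum.elim x y)))
    exact hset

/-- The sum over all ways of joining the cycle of the inserted point with a cycle of the other
circle. -/
theorem sum_join_sumCongr {X Y : Type*} [Fintype X] [Fintype Y] [DecidableEq X] [DecidableEq Y]
    {π : Perm X} {ρ : Perm Y} {j : X} {K : List X} {D : List (List X)} {E : List (List Y)}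
    (hD : IsDecomp π ((j :: K) :: D)) (hE : IsDecomp ρ E) (x : X → A) (y : Y → A) (a : A) :
    ∑ z : Y, cycProd (swap none (some (Sum.inr z)) * insertAfter (Perm.sumCongr π ρ) (Sum.inl j))
        (fun l => P.kap (l.map fun k => Option.elim k a (Sum.elim x y))) =
      (∑ i : Fin E.length, P.crossSum a (K.map x ++ [x j]) (E[i].map y) *
        ((E.eraseIdx i).map fun r => P.kap (r.map y)).prod) *
          (D.map fun l => P.kap (l.map x)).prod := by
  have huniv : (univ : Finset Y) = E.flatten.toFinset := by
    ext z
    simpa using hE.mem z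
  rw [huniv, List.sum_toFinset _ hE.nodup, List.map_flatten, List.sum_flatten, List.map_map,
    ← Fin.sum_univ_fun_getElem, Finset.sum_mul]
  refine Finset.sum_congr rfl fun i _ => ?_
  have hDE := hD.sumCongr hE
  have hp : E.Perm (E[i] :: E.eraseIdx i) := (List.getElem_cons_eraseIdx_perm i.2).symm
  have hp' : (((j :: K) :: D).map (List.map Sum.inl) ++ E.map (List.map Sum.inr)).Perm
      ((Sum.inl j :: K.map Sum.inl) :: E[i].map Sum.inr ::
        (D.map (List.map Sum.inl) ++ (E.eraseIdx i).map (List.map Sum.inr))) := by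
    rw [List.map_cons, List.cons_append, List.map_cons]
    refine List.Perm.cons _ ?_
    refine ((hp.map _).append_left _).trans ?_
    exact List.perm_middle
  have := sum_join_cycProd (hDE.perm hp') (P.kap_rotInv.comp_map
    fun k => Option.elim k a (Sum.elim x y))
  rw [List.map_map] at this
  rw [Function.comp_apply]
  refine Eq.trans this ?_
  rw [crossSum]
  simp [Function.comp_def, List.map_rotate]
  ring

end SecondOrderProbabilitySpace

/-! ### Second order cumulants with a product as entry. -/

namespace SecondOrderProbabilitySpace

variable {A : Type*} [Ring A] [Algebra ℂ A] (P : SecondOrderProbabilitySpace A)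

/-- With an empty second circle there is no cycle to join or to mark, and `φ₂` vanishes when an
argument is `1`. -/
theorem kap₂_nil_right (l : List A) : P.kap₂ l [] = 0 := by
  obtain ⟨m, x, rfl⟩ : ∃ m, ∃ x : Fin m → A, l = List.ofFn x := ⟨_, exists_eq_ofFn l⟩
  have h := P.kap₂_eq x (Fin.elim0 : Fin 0 → A)
  have h1 : annularNC m 0 = ∅ := by
    ext π
    simp [annularNC]
  simp only [pairMinSum_eq, h1, Finset.sum_empty, Finset.eq_empty_of_isEmpty (cycleMinima _),
    List.ofFn_zero, List.prod_nil, P.φ₂_one_right] at h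
  simpa using h

open scoped Classical in
/-- The contribution of a pair of permutations to the difference of the moment-cumulant formulas
for a word with a product of two letters and for the word with these letters taken apart. -/
theorem markedProd_update_sub {X Y : Type*} [Fintype X] [Fintype Y] [DecidableEq X]
    [DecidableEq Y] {π : Perm X} {ρ : Perm Y} {j : X} {K : List X} {D : List (List X)} {E : List (List Y)}
    (hD : IsDecomp π ((j :: K) :: D)) (hE : IsDecomp ρ E) (x : X → A) (y : Y → A) (a : A) :
    (P.markedProd π (Function.update x j (x j * a)) fun l =>
        P.markedProd ρ y fun r => P.kap₂ (l.map (Function.update x j (x j * a))) (r.map y)) -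
      (∑ k with (insertAfter π j).SameCycle none k,
        P.markedProd (swap none k * insertAfter π j) (fun k => Option.elim k a x) fun l =>
          P.markedProd ρ y fun r => P.kap₂ (l.map fun k => Option.elim k a x) (r.map y)) -
      (∑ z : Y, cycProd
        (swap none (some (Sum.inr z)) * insertAfter (Perm.sumCongr π ρ) (Sum.inl j))
          fun l => P.kap (l.map fun k => Option.elim k a (Sum.elim x y))) =
      (∑ i : Fin E.length, P.mulDefect (x j) a (K.map x) (E[i].map y) *
        ((E.eraseIdx i).map fun r => P.kap (r.map y)).prod) *
          (D.map fun l => P.kap (l.map x)).prod := by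
  let c : Fin E.length → ℂ := fun i => ((E.eraseIdx i).map fun r => P.kap (r.map y)).prod
  -- With the second circle summed out, `G` is the direction of perturbation on the first circle;
  -- both marked sums become second components of dual number products.
  let G : List A → ℂ := fun w => ∑ i : Fin E.length, P.kap₂ w (E[i].map y) * c i
  have hG : ∀ w, (P.markedProd ρ y fun r => P.kap₂ w (r.map y)) = G w := fun w =>
    P.markedProd_eq_sum hE y ((P.kap₂_rotInv_right w).comp_map y)
  have hGrot : RotInv G := fun l l' hr =>
    Finset.sum_congr rfl fun i _ => congrArg (· * c i) (P.kap₂_rotInv_left (E[i].map y) l l' hr)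
  have hh : RotInv (perturb P.kap G) := P.kap_rotInv.perturb hGrot
  have e1 : P.markedProd π (Function.update x j (x j * a))
      (fun l => G (l.map (Function.update x j (x j * a)))) =
      (perturb P.kap G ((x j * a) :: K.map x) *
        (D.map fun l => perturb P.kap G (l.map x)).prod).snd :=
    congrArg TrivSqZeroExt.snd (cycProd_map_update hh hD x (x j * a))
  have e2 : (∑ k with (insertAfter π j).SameCycle none k,
      P.markedProd (swap none k * insertAfter π j) (fun k => Option.elim k a x) fun l =>
          G (l.map fun k => Option.elim k a x)) =
      (cutSum (perturb P.kap G) a (K.map x ++ [x j]) *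
        (D.map fun l => perturb P.kap G (l.map x)).prod).snd := by
    rw [← sum_cut_cycProd_map hh hD]
    exact (map_sum (TrivSqZeroExt.sndHom ℂ ℂ) _ _).symm
  have hfst : ∀ l, (perturb P.kap G l).fst = P.kap l := fst_perturb _ _
  have e3 : ((D.map fun l => perturb P.kap G (l.map x)).prod).fst =
      (D.map fun l => P.kap (l.map x)).prod := by
    have := map_list_prod (TrivSqZeroExt.fstHom ℂ ℂ ℂ) (D.map fun l => perturb P.kap G (l.map x))
    simp only [TrivSqZeroExt.fstHom_apply, List.map_map] at this
    rw [this]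
    congr 1
    exact List.map_congr_left fun l _ => hfst _
  simp only [hG]
  -- The factors at the cycle of `j` have equal first components by `kap_mul_cons`, so terms with
  -- the mark on a cycle in `D` cancel. The rest is the defect at the cycle of `j`.
  rw [e1, e2, P.sum_join_sumCongr hD hE, TrivSqZeroExt.snd_mul, TrivSqZeroExt.snd_mul, hfst,
    fst_cutSum_perturb, snd_cutSum_perturb, snd_perturb, ← kap_mul_cons, e3, cutSum₂_sum]
  simp only [smul_eq_mul, MulOpposite.smul_eq_mul_unop, MulOpposite.unop_op, mulDefect, sub_mul,
    Finset.sum_sub_distrib, G, c]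
  ring

/-- Second order cumulants with a product as entry. -/
theorem kap₂_mul_cons (b a : A) (L r : List A) :
    P.kap₂ ((b * a) :: L) r =
      cutSum₂ P.kap (fun l => P.kap₂ l r) a (L ++ [b]) + P.crossSum a (L ++ [b]) r := by
  classical
  -- The moment formula used below needs two nonempty circles.
  by_cases hr : r = []
  · subst hr
    simp [kap₂_nil_right, cutSum₂, crossSum]
  suffices h : P.mulDefect b a L r = 0 by
    rw [mulDefect, sub_sub, sub_eq_zero] at h
    exact h
  induction hN : L.length + r.length using Nat.strong_induction_on generalizing L r with
  | _ N ih =>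
    obtain ⟨m, z, rfl⟩ : ∃ m, ∃ z : Fin m → A, L = List.ofFn z := ⟨_, exists_eq_ofFn L⟩
    obtain ⟨n, y, rfl⟩ : ∃ n, ∃ y : Fin n → A, r = List.ofFn y := ⟨_, exists_eq_ofFn r⟩
    rw [List.length_ofFn, List.length_ofFn] at hN
    have hn : n ≠ 0 := by simpa using hr
    subst hN
    let x : Fin (m + 1) → A := Fin.cons b z
    have hx0 : x 0 = b := rfl
    have hxs : (List.ofFn Fin.succ).map x = List.ofFn z := by
      rw [List.map_ofFn]
      rfl
    have hcyc := isCyc_finRotate_cons m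
    have hcyc' := isCyc_finRotate hn
    have hmem' : ∀ i : Fin n, i ∈ List.ofFn (id : Fin n → Fin n) := fun i =>
      List.mem_ofFn.mpr ⟨i, rfl⟩
    have hy : (List.ofFn id).map y = List.ofFn y := by rw [List.map_ofFn]; rfl
    obtain ⟨hw, hw'⟩ := map_insertAfter hcyc x (b * a) a
    have h1 := P.moment₂_eq_sum hcyc mem_cons_ofFn_succ hcyc' hmem' (Function.update x 0 (b * a)) y
    have h2 := P.moment₂_eq_sum hcyc.insertAfter_cons mem_none_cons_ofFn_succ hcyc' hmem'
      (fun k => k.elim a x) y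
    rw [hw, hxs] at h1
    rw [hw', hxs, hx0, P.annularSum_insertAfter 0 (fun i => sameCycle_finRotate 0 i), hx0] at h2
    have hφ : P.φ₂ ((b * a) :: List.ofFn z).prod = P.φ₂ (a :: (List.ofFn z ++ [b])).prod := by
      simp only [List.prod_cons, List.prod_append, List.prod_nil, mul_one]
      ext c
      rw [mul_assoc, P.φ₂_trace_left b, mul_assoc]
    have h3 := sum_geodesic_insertAfter (finRotate (m + 1)) 0
      fun π => ∑ ρ with Geodesic (finRotate n) ρ, P.markedProd π (fun k => Option.elim k a x)
        fun l => P.markedProd ρ y fun r => P.kap₂ (l.map fun k => Option.elim k a x) (r.map y)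
    have h4 : ∑ π with Geodesic (finRotate (m + 1)) π, ∑ ρ with Geodesic (finRotate n) ρ,
      ((P.markedProd π (Function.update x 0 (x 0 * a)) fun l =>
          P.markedProd ρ y fun r => P.kap₂ (l.map (Function.update x 0 (x 0 * a))) (r.map y)) -
        (∑ k with (insertAfter π 0).SameCycle none k,
          P.markedProd (swap none k * insertAfter π 0) (fun k => Option.elim k a x) fun l =>
            P.markedProd ρ y fun r => P.kap₂ (l.map fun k => Option.elim k a x) (r.map y)) -
        (∑ z : Fin n, cycProd
          (swap none (some (Sum.inr z)) * insertAfter (Perm.sumCongr π ρ) (Sum.inl 0))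
            fun l => P.kap (l.map fun k => Option.elim k a (Sum.elim x y)))) = 0 := by
      simp only [Finset.sum_sub_distrib, hx0]
      have h5 : ∀ π : Perm (Fin (m + 1)), ∑ ρ with Geodesic (finRotate n) ρ,
          ∑ k with (insertAfter π 0).SameCycle none k,
            (P.markedProd (swap none k * insertAfter π 0) (fun k => Option.elim k a x) fun l =>
              P.markedProd ρ y fun r => P.kap₂ (l.map fun k => Option.elim k a x) (r.map y)) =
          ∑ k with (insertAfter π 0).SameCycle none k, ∑ ρ with Geodesic (finRotate n) ρ,
            P.markedProd (swap none k * insertAfter π 0) (fun k => Option.elim k a x) fun l =>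
              P.markedProd ρ y fun r => P.kap₂ (l.map fun k => Option.elim k a x) (r.map y) :=
        fun π => Finset.sum_comm
      simp only [h5]
      rw [← h3]
      rw [hφ, h2] at h1
      linear_combination -h1
    -- If either permutation is not the full cycle, every defect in its contribution has smaller
    -- total length and vanishes by induction.
    rw [Finset.sum_eq_single (finRotate (m + 1)), Finset.sum_eq_single (finRotate n)] at h4
    · rw [P.markedProd_update_sub (isDecomp_finRotate_cons m) (isDecomp_finRotate hn), hxs] at h4
      simpa [hy, hx0] using h4
    · intro ρ hρ hne
      rw [P.markedProd_update_sub (isDecomp_finRotate_cons m) (isDecomp_cycles ρ)]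
      refine mul_eq_zero_of_left (Finset.sum_eq_zero fun i _ => mul_eq_zero_of_left ?_ _) _
      have hi := (isDecomp_cycles ρ).isCyc (cycles ρ)[i] (List.getElem_mem _)
      have := length_lt_of_isCyc (Finset.mem_filter.mp hρ).2 hne hi
      exact ih _ (by simpa using this) _ _ (by simpa using hi.1) rfl
    · intro h
      exact absurd (Finset.mem_filter.mpr ⟨Finset.mem_univ _, geodesic_self _⟩) h
    · intro π hπ hne
      obtain ⟨K, D, hD, hK⟩ := exists_isDecomp_cons_of_geodesic (Finset.mem_filter.mp hπ).2 hne
      refine Finset.sum_eq_zero fun ρ hρ => ?_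
      rw [P.markedProd_update_sub hD (isDecomp_cycles ρ)]
      refine mul_eq_zero_of_left (Finset.sum_eq_zero fun i _ => mul_eq_zero_of_left ?_ _) _
      have hi := (isDecomp_cycles ρ).isCyc (cycles ρ)[i] (List.getElem_mem _)
      have := length_le_of_isCyc hi
      refine ih _ ?_ _ _ (by simpa using hi.1) rfl
      simp only [List.length_map]
      omega
    · intro h
      exact absurd (Finset.mem_filter.mpr ⟨Finset.mem_univ _, geodesic_self _⟩) h

end SecondOrderProbabilitySpace

/-! ### Closed words -/

/-- The letters of the word are the edges of a closed path, where the letter `i` is an edge from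
`s i` to `t i`. -/
def ClosedWord {ι V : Type*} (s t : ι → V) (w : List ι) : Prop := w.map t = (w.map s).rotate 1

namespace ClosedWord

variable {ι V : Type*} {s t : ι → V}

theorem cons_iff {i : ι} {w : List ι} :
    ClosedWord s t (i :: w) ↔ t i :: w.map t = w.map s ++ [s i] := by
  simp [ClosedWord]

theorem of_isRotated {w w' : List ι} (h : ClosedWord s t w) (hr : w ~r w') :
    ClosedWord s t w' := by
  obtain ⟨n, rfl⟩ := hr
  rw [ClosedWord, List.map_rotate, List.map_rotate, h, List.rotate_rotate, List.rotate_rotate,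
    add_comm]

theorem iff_of_isRotated {w w' : List ι} (hr : w ~r w') :
    ClosedWord s t w ↔ ClosedWord s t w' :=
  ⟨fun h => h.of_isRotated hr, fun h => h.of_isRotated hr.symm⟩

variable {p q i : ι}

/-- The letter `i` of a closed path may be replaced by the two letters `p` and `q`. -/
theorem of_expand (hs : s i = s p) (ht : t i = t q) (hpq : t p = s q) {w : List ι}
    (h : ClosedWord s t (q :: (w ++ [p]))) : ClosedWord s t (i :: w) := by
  rw [cons_iff] at h ⊢
  rw [hs, ht]
  simp only [List.map_append, List.map_cons, List.map_nil, hpq] at h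
  rw [← List.cons_append] at h
  exact List.append_cancel_right h

theorem of_cut (hs : s i = s p) (ht : t i = t q) (hpq : t p = s q) {u v : List ι}
    (h : ClosedWord s t (q :: u)) (h' : ClosedWord s t (v ++ [p])) :
    ClosedWord s t (i :: (u ++ v)) := by
  have hr : v ++ [p] ~r p :: v := by simpa using @List.isRotated_append _ v [p]
  have h' := h'.of_isRotated hr
  rw [cons_iff] at h h' ⊢
  rw [hs, ht, List.map_append, List.map_append, ← List.cons_append, h, List.append_assoc,
    List.append_assoc, List.singleton_append, ← hpq, h']

/-- The path leaves the vertex `s q` with `q` and returns to it after `p`. There it splits into two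
closed paths, the first of which contracts to `i :: w`. -/
theorem of_cross (hs : s i = s p) (ht : t i = t q) (hpq : t p = s q) {w r : List ι}
    (h : ClosedWord s t (q :: (w ++ [p]) ++ r)) :
    ClosedWord s t (i :: w) ∧ ClosedWord s t r := by
  rw [List.cons_append, cons_iff] at h
  have e : (t q :: w.map t) ++ (t p :: r.map t) = (w.map s ++ [s p]) ++ (r.map s ++ [s q]) := by
    simpa using h
  obtain ⟨h1, h2⟩ := List.append_inj e (by simp)
  refine ⟨by rw [cons_iff, hs, ht, h1], ?_⟩
  cases r with
  | nil => rfl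
  | cons k r =>
    simp only [List.map_cons, List.cons_append, List.cons.injEq] at h2
    rw [cons_iff, ← h2.1, hpq]
    exact h2.2

end ClosedWord

/-! ### `R`-cyclic families are stable under products of composable edges. -/

namespace SecondOrderProbabilitySpace

variable {A : Type*} [Ring A] [Algebra ℂ A] (P : SecondOrderProbabilitySpace A)

/-- A family of elements indexed by the edges of a graph is second order `R`-cyclic if its only
possibly non-vanishing cumulants are those along closed paths. -/
structure IsRCyclic {ι V : Type*} (s t : ι → V) (f : ι → A) : Prop where
  first : ∀ w : List ι, ¬ ClosedWord s t w → P.kap (w.map f) = 0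
  second : ∀ w w' : List ι, ¬ (ClosedWord s t w ∧ ClosedWord s t w') →
    P.kap₂ (w.map f) (w'.map f) = 0

/-- The pairs of composable edges. -/
abbrev Composable {ι V : Type*} (s t : ι → V) := {e : ι × ι // t e.1 = s e.2}

section Products

variable {ι V : Type*} (s t : ι → V) (f : ι → A)

/-- The sources of edges and of pairs of composable edges. -/
def extendSource : ι ⊕ Composable s t → V := Sum.elim s fun e => s e.1.1

/-- The targets of edges and of pairs of composable edges. -/
def extendTarget : ι ⊕ Composable s t → V := Sum.elim t fun e => t e.1.2

/-- The elements belonging to edges, and their products for composable edges. -/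
def extendVal : ι ⊕ Composable s t → A := Sum.elim f fun e => f e.1.1 * f e.1.2

/-- The number of letters of a word which stand for products. -/
def numProducts {ι κ : Type*} (w : List (ι ⊕ κ)) : ℕ := w.countP Sum.isRight

variable {s t f}

theorem eq_map_inl_or_isRotated {ι κ : Type*} (w : List (ι ⊕ κ)) :
    (∃ u : List ι, w = u.map Sum.inl) ∨ ∃ e u, w ~r Sum.inr e :: u := by
  by_cases h : ∃ e, Sum.inr e ∈ w
  · obtain ⟨e, he⟩ := h
    obtain ⟨u, v, rfl⟩ := List.append_of_mem he
    exact Or.inr ⟨e, v ++ u, by simpa using @List.isRotated_append _ u (Sum.inr e :: v)⟩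
  · left
    induction w with
    | nil => exact ⟨[], rfl⟩
    | cons z w ih =>
      obtain ⟨u, rfl⟩ := ih fun ⟨e, he⟩ => h ⟨e, List.mem_cons_of_mem _ he⟩
      rcases z with z | e
      · exact ⟨z :: u, rfl⟩
      · exact absurd ⟨e, List.mem_cons_self⟩ h

theorem extend_closedWord_map_inl_iff {u : List ι} :
    ClosedWord (extendSource s t) (extendTarget s t) (u.map Sum.inl) ↔ ClosedWord s t u := by
  simp [ClosedWord, extendSource, extendTarget, Function.comp_def]

/-- Expanding one product by `kap_mul_cons` leaves words with fewer products. If all words in one of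
the terms were closed, they would reassemble into the original word as a closed path. -/
theorem IsRCyclic.extend_first (h : P.IsRCyclic s t f) (w : List (ι ⊕ Composable s t))
    (hw : ¬ ClosedWord (extendSource s t) (extendTarget s t) w) :
    P.kap (w.map (extendVal s t f)) = 0 := by
  induction hN : numProducts w using Nat.strong_induction_on generalizing w with
  | _ N ih =>
    rcases eq_map_inl_or_isRotated w with ⟨u, rfl⟩ | ⟨⟨⟨p, q⟩, hpq⟩, u, hr⟩
    · rw [extend_closedWord_map_inl_iff] at hw
      have hu : (u.map Sum.inl).map (extendVal s t f) = u.map f := by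
        simp [extendVal, Function.comp_def]
      rw [hu]
      exact h.first u hw
    · have hsrc : extendSource s t (Sum.inr ⟨(p, q), hpq⟩) = extendSource s t (Sum.inl p) := rfl
      have htgt : extendTarget s t (Sum.inr ⟨(p, q), hpq⟩) = extendTarget s t (Sum.inl q) := rfl
      have hpq' : extendTarget s t (Sum.inl p) = extendSource s t (Sum.inl q) := hpq
      rw [ClosedWord.iff_of_isRotated hr] at hw
      rw [P.kap_rotInv _ _ (hr.map _)]
      rw [numProducts, hr.perm.countP_eq, List.countP_cons] at hN
      simp only [Sum.isRight_inr, if_true] at hN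
      have hlt : ∀ v : List (ι ⊕ Composable s t), numProducts v ≤ u.countP Sum.isRight →
          ¬ ClosedWord (extendSource s t) (extendTarget s t) v →
          P.kap (v.map (extendVal s t f)) = 0 := fun v hv hc => ih _ (by omega) v hc rfl
      have hM : (u.map (extendVal s t f)) ++ [f p] =
          (u ++ [Sum.inl p]).map (extendVal s t f) := by simp [extendVal]
      have hcons : ∀ v : List (ι ⊕ Composable s t),
          f q :: v.map (extendVal s t f) = (Sum.inl q :: v).map (extendVal s t f) := fun v => rfl
      have hle : ∀ k, numProducts (u.take k) ≤ u.countP Sum.isRight := fun k =>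
        (List.take_sublist k u).countP_le
      have hle' : ∀ k, numProducts (u.drop k) ≤ u.countP Sum.isRight := fun k =>
        (List.drop_sublist k u).countP_le
      have hhead : (Sum.inr ⟨(p, q), hpq⟩ :: u).map (extendVal s t f) =
          (f p * f q) :: u.map (extendVal s t f) := rfl
      rw [hhead, kap_mul_cons, cutSum, hM]
      have h1 : P.kap (f q :: (u ++ [Sum.inl p]).map (extendVal s t f)) = 0 := by
        rw [hcons]
        refine hlt _ (by simp [numProducts]) fun hc => hw ?_
        exact hc.of_expand hsrc htgt hpq'
      rw [h1, zero_add]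
      refine Finset.sum_eq_zero fun k hk => ?_
      -- The cut never passes the last letter `p`, so `p` and `q` end up in different pieces.
      have hk' : k ≤ u.length := by simpa [Nat.lt_succ_iff] using hk
      rw [← List.map_take, ← List.map_drop, List.take_append_of_le_length hk',
        List.drop_append_of_le_length hk', hcons]
      by_cases hc : ClosedWord (extendSource s t) (extendTarget s t) (Sum.inl q :: u.take k)
      · refine mul_eq_zero_of_right _ (hlt _ ?_ fun hc' => hw ?_)
        · simpa [numProducts] using hle' k
        · have := hc.of_cut hsrc htgt hpq' hc'
          rwa [List.take_append_drop] at this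
      · exact mul_eq_zero_of_left (hlt _ (by simpa [numProducts] using hle k) hc) _

/-- The induction hypothesis enters as `hlt`, with `r` fixed. This lets the same step serve for a
product on either circle, by symmetry of the second order cumulants. -/
theorem IsRCyclic.extend_second_cons (h : P.IsRCyclic s t f) (e : Composable s t)
    (u r : List (ι ⊕ Composable s t))
    (hw : ¬ (ClosedWord (extendSource s t) (extendTarget s t) (Sum.inr e :: u) ∧
      ClosedWord (extendSource s t) (extendTarget s t) r))
    (hlt : ∀ v : List (ι ⊕ Composable s t), numProducts v ≤ u.countP Sum.isRight →
      ¬ (ClosedWord (extendSource s t) (extendTarget s t) v ∧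
        ClosedWord (extendSource s t) (extendTarget s t) r) →
      P.kap₂ (v.map (extendVal s t f)) (r.map (extendVal s t f)) = 0) :
    P.kap₂ ((Sum.inr e :: u).map (extendVal s t f)) (r.map (extendVal s t f)) = 0 := by
  obtain ⟨⟨p, q⟩, hpq⟩ := e
  have hsrc : extendSource s t (Sum.inr ⟨(p, q), hpq⟩) = extendSource s t (Sum.inl p) := rfl
  have htgt : extendTarget s t (Sum.inr ⟨(p, q), hpq⟩) = extendTarget s t (Sum.inl q) := rfl
  have hpq' : extendTarget s t (Sum.inl p) = extendSource s t (Sum.inl q) := hpq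
  have hM : (u.map (extendVal s t f)) ++ [f p] =
      (u ++ [Sum.inl p]).map (extendVal s t f) := by simp [extendVal]
  have hcons : ∀ v : List (ι ⊕ Composable s t),
      f q :: v.map (extendVal s t f) = (Sum.inl q :: v).map (extendVal s t f) := fun v => rfl
  have hle : ∀ k, numProducts (u.take k) ≤ u.countP Sum.isRight := fun k =>
    (List.take_sublist k u).countP_le
  have hle' : ∀ k, numProducts (u.drop k) ≤ u.countP Sum.isRight := fun k =>
    (List.drop_sublist k u).countP_le
  have hhead : (Sum.inr ⟨(p, q), hpq⟩ :: u).map (extendVal s t f) =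
      (f p * f q) :: u.map (extendVal s t f) := rfl
  rw [hhead, kap₂_mul_cons, cutSum₂, crossSum, hM]
  have h1 : P.kap₂ (f q :: (u ++ [Sum.inl p]).map (extendVal s t f)) (r.map (extendVal s t f)) =
      0 := by
    rw [hcons]
    refine hlt _ (by simp [numProducts]) fun hc => hw ⟨?_, hc.2⟩
    exact hc.1.of_expand hsrc htgt hpq'
  rw [h1, zero_add, Finset.sum_eq_zero, Finset.sum_eq_zero, add_zero]
  · intro k _
    rw [← List.map_rotate, hcons, ← List.map_append]
    refine h.extend_first P _ fun hc => hw ?_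
    have := hc.of_cross hsrc htgt hpq'
    -- The second circle was inserted in rotated form; closedness does not depend on the rotation.
    exact ⟨this.1, this.2.of_isRotated (List.IsRotated.symm ⟨k, rfl⟩)⟩
  · intro k hk
    have hk' : k ≤ u.length := by simpa [Nat.lt_succ_iff] using hk
    rw [← List.map_take, ← List.map_drop, List.take_append_of_le_length hk',
      List.drop_append_of_le_length hk', hcons]
    have hcut : ClosedWord (extendSource s t) (extendTarget s t) (Sum.inl q :: u.take k) →
        ClosedWord (extendSource s t) (extendTarget s t) (u.drop k ++ [Sum.inl p]) →
        ¬ ClosedWord (extendSource s t) (extendTarget s t) r := by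
      intro hc hc' hcr
      have := hc.of_cut hsrc htgt hpq' hc'
      rw [List.take_append_drop] at this
      exact hw ⟨this, hcr⟩
    have hn1 : numProducts (Sum.inl q :: u.take k) ≤ u.countP Sum.isRight := by
      simpa [numProducts] using hle k
    have hn2 : numProducts (u.drop k ++ [Sum.inl p]) ≤ u.countP Sum.isRight := by
      simpa [numProducts] using hle' k
    by_cases hc : ClosedWord (extendSource s t) (extendTarget s t) (Sum.inl q :: u.take k)
    · by_cases hc' : ClosedWord (extendSource s t) (extendTarget s t) (u.drop k ++ [Sum.inl p])
      · rw [hlt _ hn1 fun hh => hcut hc hc' hh.2, hlt _ hn2 fun hh => hcut hc hc' hh.2]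
        simp
      · rw [h.extend_first P _ hc', hlt _ hn2 fun hh => hc' hh.1]
        simp
    · rw [h.extend_first P _ hc, hlt _ hn1 fun hh => hc hh.1]
      simp

/-- Adding the products along composable edges to an `R`-cyclic family gives an `R`-cyclic
family. -/
theorem IsRCyclic.extend (h : P.IsRCyclic s t f) :
    P.IsRCyclic (extendSource s t) (extendTarget s t) (extendVal s t f) := by
  refine ⟨h.extend_first P, fun w w' hw => ?_⟩
  induction hN : numProducts w + numProducts w' using Nat.strong_induction_on generalizing w w' with
  | _ N ih =>
    rcases eq_map_inl_or_isRotated w with ⟨u, rfl⟩ | ⟨e, u, hr⟩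
    · rcases eq_map_inl_or_isRotated w' with ⟨u', rfl⟩ | ⟨e, u', hr⟩
      · rw [extend_closedWord_map_inl_iff, extend_closedWord_map_inl_iff] at hw
        have hu : ∀ v : List ι, (v.map Sum.inl).map (extendVal s t f) = v.map f := by
          simp [extendVal, Function.comp_def]
        rw [hu, hu]
        exact h.second u u' hw
      · rw [ClosedWord.iff_of_isRotated hr, and_comm] at hw
        rw [P.kap₂_eq_of_isRotated (List.IsRotated.refl _) (hr.map _), kap₂_comm]
        refine h.extend_second_cons P e u' _ hw fun v hv hc => ?_
        rw [kap₂_comm]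
        refine ih _ ?_ _ v (by rwa [and_comm]) rfl
        rw [← hN, numProducts, numProducts, numProducts, hr.perm.countP_eq, List.countP_cons]
        simp only [Sum.isRight_inr, if_true]
        rw [numProducts] at hv
        omega
    · rw [ClosedWord.iff_of_isRotated hr] at hw
      rw [P.kap₂_eq_of_isRotated (hr.map _) (List.IsRotated.refl _)]
      refine h.extend_second_cons P e u _ hw fun v hv hc => ?_
      refine ih _ ?_ v _ hc rfl
      rw [← hN, numProducts, numProducts, numProducts, hr.perm.countP_eq, List.countP_cons]
      simp only [Sum.isRight_inr, if_true]
      rw [numProducts] at hv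
      omega

end Products

end SecondOrderProbabilitySpace

/-! ### Alternating words -/

theorem eq_xor_odd_of_consecutive_ne {n : ℕ} {ε : Fin n → Bool}
    (h : ∀ i j : Fin n, (j : ℕ) = i + 1 → ε i ≠ ε j) (k : ℕ) (hk : k < n) :
    ε ⟨k, hk⟩ = xor (ε ⟨0, by omega⟩) (decide (Odd k)) := by
  induction k with
  | zero => simp
  | succ k ih =>
    have h1 := h ⟨k, by omega⟩ ⟨k + 1, hk⟩ rfl
    rw [ih (by omega)] at h1
    have h2 : decide (Odd (k + 1)) = !decide (Odd k) := by
      rw [← decide_not]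
      exact decide_eq_decide.mpr Nat.odd_add_one
    rw [h2]
    revert h1
    cases ε ⟨k + 1, hk⟩ <;> cases ε ⟨0, by omega⟩ <;> cases decide (Odd k) <;> simp

/-- Alternation is the vanishing condition for edges between two vertices. -/
theorem alternates_iff {n : ℕ} {ε : Fin n → Bool} :
    Alternates ε ↔ ∀ i, (!ε i) = ε (finRotate n i) := by
  have hval := fun i : Fin n => val_finRotate_apply i
  -- Evenness of `n` is exactly the alternation condition at the step from the last letter back to
  -- the first.
  have hlast : ∀ (h : ∀ i j : Fin n, (j : ℕ) = i + 1 → ε i ≠ ε j) (i : Fin n), (i : ℕ) + 1 = n →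
      (ε i ≠ ε (finRotate n i) ↔ Even n) := by
    intro h i hi
    have h0 : finRotate n i = ⟨0, by omega⟩ := Fin.ext (by rw [hval, hi, Nat.mod_self])
    rw [h0, eq_xor_odd_of_consecutive_ne h i i.2]
    have hev : Even n ↔ Odd (i : ℕ) := by
      have := Nat.even_add_one (n := (i : ℕ))
      rwa [hi, Nat.not_even_iff_odd] at this
    rw [hev]
    by_cases ho : Odd (i : ℕ) <;> simp [ho]
  have hne : ∀ x y : Bool, (!x) = y ↔ x ≠ y := by decide
  simp only [hne]
  constructor
  · rintro ⟨he, h⟩ i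
    by_cases hi : (i : ℕ) + 1 = n
    · exact (hlast h i hi).mpr he
    · refine h i _ ?_
      rw [hval, Nat.mod_eq_of_lt (by have := i.2; omega)]
  · intro h
    have h' : ∀ i j : Fin n, (j : ℕ) = i + 1 → ε i ≠ ε j := by
      intro i j hij
      have : j = finRotate n i := Fin.ext (by
        rw [hval, Nat.mod_eq_of_lt (by have := j.2; omega), hij])
      rw [this]
      exact h i
    refine ⟨?_, h'⟩
    cases n with
    | zero => simp
    | succ n => exact (hlast h' (Fin.last n) (by simp)).mp (h _)

theorem closedWord_ofFn_iff {ι V : Type*} {s t : ι → V} {n : ℕ} {w : Fin n → ι} :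
    ClosedWord s t (List.ofFn w) ↔ ∀ i, t (w i) = s (w (finRotate n i)) := by
  rw [ClosedWord, List.map_ofFn, List.map_ofFn, ← ofFn_comp_finRotate, List.ofFn_inj, funext_iff]
  rfl

/-- On a circle of even length, shifting by one flips the parity of every position, also at the
wrap-around. -/
theorem star_altWord {A : Type*} [InvolutiveStar A] (c : A) (p : ℕ) :
    List.ofFn (fun i => star (altWord c p i)) = (List.ofFn (altWord c p)).rotate 1 := by
  rw [← ofFn_comp_finRotate]
  congr 1
  funext i
  have hpar : Even ((finRotate (2 * p) i : Fin (2 * p)) : ℕ) ↔ ¬ Even (i : ℕ) := by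
    rw [val_finRotate_apply, Nat.even_iff, Nat.mod_mod_of_dvd _ (Dvd.intro p rfl), Nat.even_iff]
    omega
  simp only [altWord, Function.comp_apply, hpar]
  by_cases hi : Even (i : ℕ) <;> simp [hi]

/-! ### The graph of the letters `a`, `a*`, `b`, `b*`. -/

namespace SecondOrderProbabilitySpace

/-- The letters `a`, `a*` (on the left) and `b`, `b*` (on the right). -/
def starVal {A : Type*} [Star A] (a b : A) : Bool ⊕ Bool → A :=
  Sum.elim (fun e => if e then a else star a) fun e => if e then b else star b

/-- The index of the family containing a letter. -/
def letterIndex : Bool ⊕ Bool → Fin 2 := Sum.elim (fun _ => 0) fun _ => 1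

theorem starVal_mem {A : Type*} [Star A] {a b : A} (i : Bool ⊕ Bool) :
    starVal a b i ∈ (![{a, star a}, {b, star b}] : Fin 2 → Set A) (letterIndex i) := by
  rcases i with (_ | _) | (_ | _) <;> simp [starVal, letterIndex]

variable {A : Type*} [Ring A] [Algebra ℂ A] (P : SecondOrderProbabilitySpace A)

/-- The letter `a` is an edge from `true` to `false`, the letter `a*` is an edge from `false` to
`true`, and the letters `b` and `b*` are loops at `false`. -/
def starSource : Bool ⊕ Bool → Bool := Sum.elim id fun _ => false

/-- The targets of the letters. -/
def starTarget : Bool ⊕ Bool → Bool := Sum.elim not fun _ => false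

theorem alternates_of_inl {n : ℕ} {ε : Fin n → Bool} :
    ClosedWord starSource starTarget (List.ofFn fun i => Sum.inl (ε i)) ↔ Alternates ε := by
  rw [closedWord_ofFn_iff, alternates_iff]
  rfl

theorem closedWord_of_inr {n : ℕ} {w : Fin n → Bool ⊕ Bool} (h : ∀ i, (w i).isRight) :
    ClosedWord starSource starTarget (List.ofFn w) := by
  rw [closedWord_ofFn_iff]
  have hs : ∀ i, starSource (w i) = false ∧ starTarget (w i) = false := by
    intro i
    obtain ⟨e, he⟩ := Sum.isRight_iff.mp (h i)
    simp [he, starSource, starTarget]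
  intro i
  rw [(hs _).1, (hs _).2]

variable [Star A] {a b : A}

/-- Freeness leaves only unmixed words. Those in `a`, `a*` are handled by `R`-diagonality, and those
in `b`, `b*` are always closed. -/
theorem letterIndex_eq {ι : Type*} {w : ι → Bool ⊕ Bool}
    (h : ∀ i j, letterIndex (w i) = letterIndex (w j)) :
    (∃ ε : ι → Bool, w = fun i => Sum.inl (ε i)) ∨ ∀ i, (w i).isRight := by
  by_cases hr : ∀ i, (w i).isRight
  · exact Or.inr hr
  · left
    push Not at hr
    obtain ⟨j, hj⟩ := hr
    have hl : ∀ i, ∃ e, w i = Sum.inl e := by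
      intro i
      have := h i j
      rcases hi : w i with e | e
      · exact ⟨e, rfl⟩
      · rcases hj' : w j with e' | e'
        · rw [hi, hj'] at this
          simp [letterIndex] at this
        · simp [hj'] at hj
    choose ε hε using hl
    exact ⟨ε, funext hε⟩

/-- If `a` is second order `R`-diagonal and second order `*`-free from `b`, then the letters `a`,
`a*`, `b`, `b*` form an `R`-cyclic family. -/
theorem IsSecondOrderRDiagonal.isRCyclic (hfree : P.SecondOrderFree ![{a, star a}, {b, star b}])
    (ha : P.IsSecondOrderRDiagonal a) : P.IsRCyclic starSource starTarget (starVal a b) := by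
  constructor
  · intro w hw
    obtain ⟨n, w, rfl⟩ : ∃ n, ∃ x : Fin n → Bool ⊕ Bool, w = List.ofFn x := ⟨_, exists_eq_ofFn w⟩
    rw [List.map_ofFn, ← cumulant_eq_kap]
    by_cases hmix : ∃ i j, letterIndex (w i) ≠ letterIndex (w j)
    · exact hfree.first n (fun i => letterIndex (w i)) _ (fun i => starVal_mem (w i)) hmix
    · push Not at hmix
      rcases letterIndex_eq hmix with ⟨ε, rfl⟩ | hr
      · rw [alternates_of_inl] at hw
        exact ha.first n ε hw
      · exact absurd (closedWord_of_inr hr) hw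
  · intro w w' hw
    obtain ⟨m, w, rfl⟩ : ∃ n, ∃ x : Fin n → Bool ⊕ Bool, w = List.ofFn x := ⟨_, exists_eq_ofFn w⟩
    obtain ⟨n, w', rfl⟩ : ∃ n, ∃ x : Fin n → Bool ⊕ Bool, w' = List.ofFn x :=
      ⟨_, exists_eq_ofFn w'⟩
    rw [List.map_ofFn, List.map_ofFn, ← cumulant₂_eq_kap₂]
    have happ : Fin.append (fun i => letterIndex (w i)) (fun j => letterIndex (w' j)) =
        fun k => letterIndex (Fin.append w w' k) := by
      funext k
      refine Fin.addCases (fun i => ?_) (fun j => ?_) k <;> simp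
    by_cases hmix : ∃ k k', letterIndex (Fin.append w w' k) ≠ letterIndex (Fin.append w w' k')
    · exact hfree.second m n (fun i => letterIndex (w i)) (fun j => letterIndex (w' j)) _ _
        (fun i => starVal_mem (w i)) (fun j => starVal_mem (w' j)) (by rw [happ]; exact hmix)
    · push Not at hmix
      rcases letterIndex_eq hmix with ⟨ε, hε⟩ | hr
      · have h1 : w = fun i => Sum.inl (ε (Fin.castAdd n i)) := funext fun i => by
          rw [← congrFun hε (Fin.castAdd n i), Fin.append_left]
        have h2 : w' = fun j => Sum.inl (ε (Fin.natAdd m j)) := funext fun j => by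
          rw [← congrFun hε (Fin.natAdd m j), Fin.append_right]
        subst h1 h2
        rw [alternates_of_inl, alternates_of_inl] at hw
        exact ha.second m n _ _ hw
      · refine absurd ⟨closedWord_of_inr fun i => ?_, closedWord_of_inr fun j => ?_⟩ hw
        · simpa using hr (Fin.castAdd n i)
        · simpa using hr (Fin.natAdd m j)

/-- The letter for `ab` (`true`) or `b* a*` (`false`). -/
def productLetter (e : Bool) : (Bool ⊕ Bool) ⊕ Composable starSource starTarget :=
  Sum.inr (if e then ⟨(Sum.inl true, Sum.inr true), rfl⟩ else ⟨(Sum.inr false, Sum.inl false), rfl⟩)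

end SecondOrderProbabilitySpace

theorem closedWord_productLetter_iff {n : ℕ} {ε : Fin n → Bool} :
    ClosedWord (SecondOrderProbabilitySpace.extendSource SecondOrderProbabilitySpace.starSource
      SecondOrderProbabilitySpace.starTarget) (SecondOrderProbabilitySpace.extendTarget
        SecondOrderProbabilitySpace.starSource SecondOrderProbabilitySpace.starTarget)
      (List.ofFn fun i => SecondOrderProbabilitySpace.productLetter (ε i)) ↔ Alternates ε := by
  rw [closedWord_ofFn_iff, alternates_iff]
  refine forall_congr' fun i => ?_
  have hs : ∀ e, SecondOrderProbabilitySpace.extendSource SecondOrderProbabilitySpace.starSource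
      SecondOrderProbabilitySpace.starTarget (SecondOrderProbabilitySpace.productLetter e) = e := by
    rintro (_ | _) <;> rfl
  have ht : ∀ e, SecondOrderProbabilitySpace.extendTarget SecondOrderProbabilitySpace.starSource
      SecondOrderProbabilitySpace.starTarget (SecondOrderProbabilitySpace.productLetter e) =
        !e := by
    rintro (_ | _) <;> rfl
  rw [hs, ht]

theorem map_productLetter {A : Type*} [Ring A] [StarRing A] (a b : A) {n : ℕ} (ε : Fin n → Bool) :
    (List.ofFn fun i => SecondOrderProbabilitySpace.productLetter (ε i)).map
      (SecondOrderProbabilitySpace.extendVal SecondOrderProbabilitySpace.starSource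
        SecondOrderProbabilitySpace.starTarget (SecondOrderProbabilitySpace.starVal a b)) =
      List.ofFn (starWord (a * b) ε) := by
  rw [List.map_ofFn]
  congr 1
  funext i
  rw [Function.comp_apply, starWord]
  cases ε i
  · rw [if_neg (by simp), star_mul]
    rfl
  · rfl

end

/-! ### The product `ab` is second order `R`-diagonal. -/

theorem theorem3p3 {A : Type*} [Ring A] [Algebra ℂ A] [StarRing A] [StarModule ℂ A]
    (P : SecondOrderProbabilitySpace A) (a b : A)
    (hfree : P.SecondOrderFree ![{a, star a}, {b, star b}])
    (ha : P.IsSecondOrderRDiagonal a) :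
    P.IsSecondOrderRDiagonal (a * b) := by
  have h := (ha.isRCyclic P hfree).extend P
  refine ⟨fun n ε hε => ?_, fun m n ε δ hεδ => ?_, fun p q => ?_⟩
  · rw [P.cumulant_eq_kap, ← map_productLetter]
    exact h.first _ (closedWord_productLetter_iff.not.mpr hε)
  · rw [P.cumulant₂_eq_kap₂, ← map_productLetter, ← map_productLetter]
    refine h.second _ _ ?_
    rwa [closedWord_productLetter_iff, closedWord_productLetter_iff]
  · rw [P.cumulant₂_eq_kap₂, P.cumulant₂_eq_kap₂, star_altWord, star_altWord]
    -- Taking adjoints has become a rotation by one on each circle.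
    exact P.kap₂_eq_of_isRotated ⟨1, rfl⟩ ⟨1, rfl⟩
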